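/- For each positive integer $n$, let $M_n$ be a random symmetric $n\times n$ real matrix whose entries $(M_n)_{ij}$ with $1\le i\le j\le n$ (on and above the diagonal) are independent and identically distributed, taking each of the values $1$ and $-1$ with probability $1/2$, and let $q_n$ be the probability that $M_n$ is singular. Then there exists $n_0\in\mathbb{N}$ such that for all $n\ge n_0$, $$q_n\le 2^{-n^{1/4}\sqrt{\log n}/1000},$$ where $\log$ is the natural logarithm. -/

import Mathlib

open MeasureTheory ProbabilityTheory
open scoped ENNReal

/-- The law of a random variable taking the values `1` and `-1` with probability `1/2` each. -/
noncomputable def signLaw : Measure ℝ :=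
  (1 / 2 : ℝ≥0∞) • Measure.dirac 1 + (1 / 2 : ℝ≥0∞) • Measure.dirac (-1)

/-- `M` is a random symmetric `n × n` matrix on the probability space `(Ω, P)` whose entries on
and above the diagonal are independent and take the values `1` and `-1` with probability `1/2`
each. -/
structure IsRandomSymmetricSignMatrix {Ω : Type*} [MeasurableSpace Ω] (P : Measure Ω) (n : ℕ)
    (M : Ω → Matrix (Fin n) (Fin n) ℝ) : Prop where
  isSymm : ∀ ω, (M ω).IsSymm
  hasLaw : ∀ i j : Fin n, i ≤ j → HasLaw (fun ω => M ω i j) signLaw P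
  indep : iIndepFun
    (fun (p : {p : Fin n × Fin n // p.1 ≤ p.2}) (ω : Ω) => M ω p.1.1 p.1.2) P

/-!
The probability space only enters through the uniform distribution on sign patterns
`σ : Sym2 V → Bool`, and singularity over `ℝ` implies singularity modulo every prime. So fix `k`
of order `n ^ (1/4) * √(log n)` and a prime `p` with `2 ^ (k - 1) < p ≤ 2 ^ k`, and bound the
probability that the sign matrix is singular over `ℤ/pℤ`. Any `k` between `C * log n` and
`c * n ^ (1/3)` would do; the resulting bound is of order `2 ^ (-k / 4)`.

*Structured vectors.* The quantity `charBound v I`, the mean over frequencies `ξ` of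
`∏ i ∈ I, |cos (2πξvᵢ/p)|`, bounds the probability that a random signed sum of the entries `vᵢ`,
`i ∈ I`, takes a given value. Call `v` structured if `charBound v > 5 / p`, possibly after a few
coordinates are discarded. `pr_exists_structured_le` says that for fixed `w` it is unlikely that
`M v = w` for some structured `v ≠ 0`. This is a union bound. Vectors with few nonzero entries are
few, and each satisfies `M v = w` with probability at most `2 ^ (1 - n)`. For the others the Halász
inequality `charBound_le_zeroProb` (low-energy frequencies, Cauchy–Davenport) shows that
`charBound` is smaller by a large constant factor than the probability `goodProb` that a short
random signed sum of entries vanishes and uses some index exactly once. Vectors for which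
`goodProb` is large on all index sets of size `s` are rare, by `sum_minGoodProb_pow_le`: such a
vanishing sum determines one entry from the others, so entries can be eliminated one by one. The
number of such vectors and the power `charBound v I ^ (n - s)` from the independent rows nearly
cancel, and the constant factor gained in each row wins.

*Growing the matrix.* Add rows and columns one at a time. While the matrix is singular, it has a
kernel vector, which is likely to be unstructured, hence unlikely to be orthogonal to the new
column; otherwise the corank drops (`corank_lt_of_leading`). Started at half the final size, the
corank reaches zero in time, so a singular matrix very likely has a nonsingular leading submatrix
`N` of size one less (`pr_corank_pos_le`).

*Decoupling.* In that case the last column `x` satisfies a quadratic equation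
`x ⬝ᵥ N⁻¹ x = d`. Cauchy–Schwarz, applied twice, replaces it by a linear equation in the
coordinates of `x` outside a set `J` of size `k`, with coefficient vector `u = N⁻¹ w` for a fixed
`w ≠ 0`. As `N u = w`, the vector `u` is likely to be unstructured, and the linear equation is
unlikely (`pr_corank_leading_eq_zero_pow_le`).
-/

open Finset Function
open scoped BigOperators

/-! ### Uniform probability on finite types -/

open Classical in
/-- The probability of the event `p` under the uniform distribution on the finite type `α`. -/
noncomputable def pr {α : Type*} [Fintype α] (p : α → Prop) : ℝ :=
  𝔼 a, if p a then (1 : ℝ) else 0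

section Probability

variable {α β ι E : Type*} [Fintype α] [Fintype β]

lemma pr_nonneg (p : α → Prop) : 0 ≤ pr p :=
  expect_nonneg fun a _ => by split_ifs <;> norm_num

lemma pr_le_one (p : α → Prop) : pr p ≤ 1 := by
  rcases isEmpty_or_nonempty α with h | h
  · simp [pr]
  · exact expect_le univ_nonempty fun a _ => by split_ifs <;> norm_num

lemma pr_mono {p q : α → Prop} (h : ∀ a, p a → q a) : pr p ≤ pr q := by
  classical
  refine expect_le_expect fun a _ => ?_
  by_cases hp : p a
  · simp [hp, h a hp]
  · simp only [hp, if_false]; split_ifs <;> norm_num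

lemma pr_congr {p q : α → Prop} (h : ∀ a, p a ↔ q a) : pr p = pr q :=
  le_antisymm (pr_mono fun a => (h a).1) (pr_mono fun a => (h a).2)

lemma pr_or_le (p q : α → Prop) : pr (fun a => p a ∨ q a) ≤ pr p + pr q := by
  classical
  unfold pr
  rw [← expect_add_distrib]
  refine expect_le_expect fun a _ => ?_
  by_cases hp : p a <;> by_cases hq : q a <;> simp [hp, hq]

lemma pr_false : pr (fun _ : α => False) = 0 := by simp [pr]

lemma pr_exists_le (s : Finset ι) (p : ι → α → Prop) :
    pr (fun a => ∃ i ∈ s, p i a) ≤ ∑ i ∈ s, pr (p i) := by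
  classical
  induction s using Finset.induction_on with
  | empty => simp [pr_false]
  | insert i s hi ih =>
    rw [sum_insert hi]
    calc pr (fun a => ∃ j ∈ insert i s, p j a)
        ≤ pr (fun a => p i a ∨ ∃ j ∈ s, p j a) := pr_mono fun a => by simp
      _ ≤ _ := (pr_or_le _ _).trans (by gcongr)

lemma pr_eq_card (p : α → Prop) [DecidablePred p] :
    pr p = (#{a | p a} : ℝ) / Fintype.card α := by
  unfold pr
  rw [Fintype.expect_eq_sum_div_card]
  congr 1
  rw [card_filter]
  push_cast
  exact sum_congr rfl fun a _ => by congr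

lemma pr_equiv (e : α ≃ β) (p : β → Prop) : pr (fun a => p (e a)) = pr p := by
  classical
  exact Fintype.expect_equiv e _ _ fun a => rfl

lemma pr_prod (p : α × β → Prop) : pr p = 𝔼 a, pr fun b => p (a, b) := by
  unfold pr
  rw [← univ_product_univ, expect_product]

/-- Independent coordinates: the probability of a product event is the product. -/
lemma pr_forall [Fintype ι] [DecidableEq ι] (p : ι → α → Prop) :
    pr (fun x : ι → α => ∀ i, p i (x i)) = ∏ i, pr (p i) := by
  classical
  simp only [pr_eq_card, prod_div_distrib, prod_const, card_univ, Fintype.card_fun, Nat.cast_pow]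
  congr 1
  rw [← Nat.cast_prod, ← Fintype.card_piFinset]
  congr 2
  ext x
  simp

/-- Resampling: overwriting the coordinates of a uniform sample along an injection `e` by an
independent uniform sample does not change its law, because
`(σ, x) ↦ (extend e x σ, σ ∘ e)` is an involution. -/
lemma expect_extend [Fintype E] [DecidableEq E] [Fintype ι] [DecidableEq ι] [Nonempty α]
    {e : ι → E} (he : Injective e) (f : (E → α) → ℝ) :
    𝔼 σ, f σ = 𝔼 σ : E → α, 𝔼 x : ι → α, f (extend e x σ) := by
  have key : Involutive fun y : (E → α) × (ι → α) => (extend e y.2 y.1, y.1 ∘ e) := by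
    rintro ⟨σ, x⟩
    refine Prod.ext ?_ (extend_comp he _ _)
    funext b
    by_cases hb : ∃ a, e a = b
    · obtain ⟨a, rfl⟩ := hb
      simp [he.extend_apply]
    · simp [extend_apply' _ _ _ hb]
  calc 𝔼 σ, f σ = 𝔼 σ : E → α, 𝔼 _x : ι → α, f σ := by
        simp only [Fintype.expect_const]
    _ = 𝔼 y : (E → α) × (ι → α), f y.1 := by
        rw [← univ_product_univ, expect_product]
    _ = 𝔼 y : (E → α) × (ι → α), f (extend e y.2 y.1) :=
        (Fintype.expect_equiv key.toPerm _ _ fun y => rfl).symm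
    _ = _ := by rw [← univ_product_univ, expect_product]

lemma pr_extend [Fintype E] [DecidableEq E] [Fintype ι] [DecidableEq ι] [Nonempty α]
    {e : ι → E} (he : Injective e) (p : (E → α) → Prop) :
    pr p = 𝔼 σ : E → α, pr fun x : ι → α => p (extend e x σ) :=
  expect_extend he _

/-- Conditioning on all coordinates outside the range of `e`. -/
lemma pr_le_add_of_extend [Fintype E] [DecidableEq E] [Fintype ι] [DecidableEq ι] [Nonempty α]
    {e : ι → E} (he : Injective e) {p b : (E → α) → Prop} {c : ℝ} (hc : 0 ≤ c)
    (h : ∀ σ, ¬ b σ → pr (fun x : ι → α => p (extend e x σ)) ≤ c) : pr p ≤ pr b + c := by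
  classical
  rw [pr_extend he, ← Fintype.expect_const (ι := E → α) c, pr, ← expect_add_distrib]
  refine expect_le_expect fun σ _ => ?_
  by_cases hb : b σ
  · simpa [hb] using (pr_le_one _).trans (by linarith)
  · simpa [hb] using h σ hb

lemma pr_le_of_extend [Fintype E] [DecidableEq E] [Fintype ι] [DecidableEq ι] [Nonempty α]
    {e : ι → E} (he : Injective e) {p : (E → α) → Prop} {c : ℝ}
    (h : ∀ σ, pr (fun x : ι → α => p (extend e x σ)) ≤ c) : pr p ≤ c := by
  rw [pr_extend he]
  exact expect_le univ_nonempty fun σ _ => h σ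

/-- The marginal of a uniform sample along an injection is uniform. -/
lemma pr_comp [Fintype E] [DecidableEq E] [Fintype ι] [DecidableEq ι] [Nonempty α]
    {e : ι → E} (he : Injective e) (p : (ι → α) → Prop) :
    pr (fun σ : E → α => p (σ ∘ e)) = pr p := by
  rw [pr_extend he]
  simp only [extend_comp he, Fintype.expect_const]

/-- Resampling the coordinates in `J`. -/
lemma expect_piecewise [Fintype ι] [DecidableEq ι] (J : Finset ι) (f : (ι → α) → ℝ) :
    𝔼 x, f x = 𝔼 y : ι → α, 𝔼 z : ι → α, f (J.piecewise z y) := by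
  rcases isEmpty_or_nonempty (ι → α) with h | h
  · simp
  have key : Involutive fun y : (ι → α) × (ι → α) =>
      (J.piecewise y.2 y.1, J.piecewise y.1 y.2) := by
    rintro ⟨σ, x⟩
    refine Prod.ext ?_ ?_ <;> funext b <;> by_cases hb : b ∈ J <;> simp [hb]
  calc 𝔼 x, f x = 𝔼 σ : ι → α, 𝔼 _x : ι → α, f σ := by
        simp only [Fintype.expect_const]
    _ = 𝔼 y : (ι → α) × (ι → α), f y.1 := by
        rw [← univ_product_univ, expect_product]
    _ = 𝔼 y : (ι → α) × (ι → α), f (J.piecewise y.2 y.1) :=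
        (Fintype.expect_equiv key.toPerm _ _ fun y => rfl).symm
    _ = _ := by rw [← univ_product_univ, expect_product]

lemma pr_piecewise [Fintype ι] [DecidableEq ι] (J : Finset ι) (p : (ι → α) → Prop) :
    pr p = 𝔼 y : ι → α, pr fun z : ι → α => p (J.piecewise z y) :=
  expect_piecewise J _

/-- Cauchy–Schwarz in the form used for decoupling: duplicating the second variable. -/
lemma sq_pr_le_pr_dup (p : α → β → Prop) :
    pr (fun y : α × β => p y.1 y.2) ^ 2 ≤
      pr (fun y : α × β × β => p y.1 y.2.1 ∧ p y.1 y.2.2) := by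
  classical
  rcases isEmpty_or_nonempty α with h | h
  · simp [pr]
  rw [pr_prod, pr_prod]
  have h1 : (𝔼 a, pr fun b => p a b) ^ 2 ≤ 𝔼 a, (pr fun b => p a b) ^ 2 := by
    have := expect_mul_sq_le_sq_mul_sq univ (fun a => pr fun b => p a b) (fun _ : α => (1 : ℝ))
    simpa using this
  refine h1.trans (expect_le_expect fun a _ => le_of_eq ?_)
  rw [pr_prod, sq, pr, expect_mul_expect]
  refine expect_congr rfl fun b _ => ?_
  unfold pr
  refine expect_congr rfl fun b' _ => ?_
  by_cases hb : p a b <;> by_cases hb' : p a b' <;> simp [hb, hb']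

end Probability

/-! ### Characters of `ℤ/pℤ` and the Littlewood–Offord bound -/

/-- The sign `1` or `-1` encoded by a Boolean. -/
def sgn (R : Type*) [Ring R] (b : Bool) : R := bif b then 1 else -1

section Fourier

variable {p : ℕ} [Fact p.Prime] {ι : Type*}

/-- `cos (2πt/p)`, the real part of the standard character of `ℤ/pℤ`. -/
noncomputable def cosMod (t : ZMod p) : ℝ := (ZMod.stdAddChar t).re

/-- `sin (2πt/p)`, the imaginary part of the standard character of `ℤ/pℤ`. -/
noncomputable def sinMod (t : ZMod p) : ℝ := (ZMod.stdAddChar t).im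

lemma cosMod_sq_add_sinMod_sq (t : ZMod p) : cosMod t ^ 2 + sinMod t ^ 2 = 1 := by
  have h : ‖ZMod.stdAddChar t‖ = 1 := by rw [ZMod.stdAddChar_apply]; exact Circle.norm_coe _
  have h2 := Complex.sq_norm (ZMod.stdAddChar t)
  rw [h, Complex.normSq_apply] at h2
  unfold cosMod sinMod
  linarith

lemma cosMod_zero : cosMod (0 : ZMod p) = 1 := by simp [cosMod]

lemma sinMod_zero : sinMod (0 : ZMod p) = 0 := by simp [sinMod]

lemma abs_cosMod_le_one (t : ZMod p) : |cosMod t| ≤ 1 := by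
  rw [abs_le_one_iff_mul_self_le_one]
  nlinarith [cosMod_sq_add_sinMod_sq t, sq_nonneg (sinMod t)]

lemma cosMod_add (s t : ZMod p) : cosMod (s + t) = cosMod s * cosMod t - sinMod s * sinMod t := by
  simp [cosMod, sinMod, AddChar.map_add_eq_mul, Complex.mul_re]

lemma sinMod_add (s t : ZMod p) : sinMod (s + t) = cosMod s * sinMod t + sinMod s * cosMod t := by
  simp [cosMod, sinMod, AddChar.map_add_eq_mul, Complex.mul_im]

lemma cosMod_two_mul (t : ZMod p) : cosMod (2 * t) = 1 - 2 * sinMod t ^ 2 := by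
  rw [two_mul, cosMod_add]
  linarith [cosMod_sq_add_sinMod_sq t]

lemma sinMod_add_sq_le (s t : ZMod p) :
    sinMod (s + t) ^ 2 ≤ 2 * (sinMod s ^ 2 + sinMod t ^ 2) := by
  have h : |sinMod (s + t)| ≤ |sinMod s| + |sinMod t| := by
    rw [sinMod_add]
    refine (abs_add_le _ _).trans ?_
    rw [abs_mul, abs_mul, add_comm]
    exact add_le_add (mul_le_of_le_one_right (abs_nonneg _) (abs_cosMod_le_one t))
      (mul_le_of_le_one_left (abs_nonneg _) (abs_cosMod_le_one s))
  have h2 := abs_le_abs_of_nonneg (abs_nonneg _) h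
  nlinarith [sq_abs (sinMod (s + t)), sq_abs (sinMod s), sq_abs (sinMod t),
    sq_nonneg (|sinMod s| - |sinMod t|), abs_nonneg (sinMod (s + t)),
    abs_nonneg (sinMod s), abs_nonneg (sinMod t)]

/-- Averaging the character over a random sign leaves its real part. -/
lemma expect_stdAddChar_sgn (t : ZMod p) :
    𝔼 b : Bool, ZMod.stdAddChar (sgn (ZMod p) b * t) = (cosMod t : ℂ) := by
  have h : (ZMod.stdAddChar (-t) : ℂ) = starRingEnd ℂ (ZMod.stdAddChar t) := by
    rw [AddChar.map_neg_eq_inv, ZMod.stdAddChar_apply, ← Circle.coe_inv, Circle.coe_inv_eq_conj]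
  rw [Fintype.expect_eq_sum_div_card]
  simp only [Fintype.sum_bool, sgn, cond_true, cond_false, one_mul, neg_mul, h, Fintype.card_bool,
    Complex.add_conj]
  simp [cosMod]

lemma expect_stdAddChar_mul (t : ZMod p) :
    𝔼 ξ : ZMod p, (ZMod.stdAddChar (ξ * t) : ℂ) = if t = 0 then 1 else 0 := by
  rw [Fintype.expect_eq_sum_div_card, AddChar.sum_mulShift _ (ZMod.isPrimitive_stdAddChar p)]
  split_ifs
  · rw [ZMod.card, div_self]
    exact_mod_cast (Fact.out : p.Prime).ne_zero
  · simp

lemma expect_cosMod_mul {t : ZMod p} (ht : t ≠ 0) : 𝔼 ξ : ZMod p, cosMod (ξ * t) = 0 := by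
  have h := congrArg Complex.re (expect_stdAddChar_mul t)
  rw [if_neg ht, Fintype.expect_eq_sum_div_card] at h
  rw [Fintype.expect_eq_sum_div_card]
  simpa [cosMod, Complex.div_natCast_re, Complex.re_sum] using h

lemma pr_eq_zero_eq_expect {α : Type*} [Fintype α] (φ : α → ZMod p) :
    (pr (fun a => φ a = 0) : ℂ) = 𝔼 ξ : ZMod p, 𝔼 a, (ZMod.stdAddChar (ξ * φ a) : ℂ) := by
  rw [expect_comm]
  simp only [expect_stdAddChar_mul]
  rw [pr, Fintype.expect_eq_sum_div_card, Fintype.expect_eq_sum_div_card]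
  push_cast
  congr 1
  refine sum_congr rfl fun a _ => ?_
  by_cases h : φ a = 0 <;> simp [h]

lemma expect_pi_prod {α K : Type*} [Fintype α] [Fintype ι] [DecidableEq ι] [Field K] [CharZero K]
    (f : ι → α → K) : 𝔼 x : ι → α, ∏ i, f i (x i) = ∏ i, 𝔼 a, f i a := by
  simp only [Fintype.expect_eq_sum_div_card, prod_div_distrib, prod_const, card_univ]
  rw [Fintype.prod_sum, Fintype.card_fun, Nat.cast_pow]

lemma expect_stdAddChar_sum {α : Type*} [Fintype α] [Fintype ι] [DecidableEq ι] (ξ : ZMod p)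
    (φ : ι → α → ZMod p) :
    𝔼 x : ι → α, (ZMod.stdAddChar (ξ * ∑ i, φ i (x i)) : ℂ) =
      ∏ i, 𝔼 a, (ZMod.stdAddChar (ξ * φ i a) : ℂ) := by
  rw [← expect_pi_prod]
  refine expect_congr rfl fun x _ => ?_
  rw [mul_sum]
  exact map_prod (ZMod.stdAddChar (N := p)).toMonoidHom
    (fun i => Multiplicative.ofAdd (ξ * φ i (x i))) univ

/-- The Fourier upper bound `𝔼_ξ ∏_{i ∈ I} |cos (2πξvᵢ/p)|` for the concentration of the random
signed sum of the `vᵢ`, `i ∈ I`. -/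
noncomputable def charBound (v : ι → ZMod p) (I : Finset ι) : ℝ :=
  𝔼 ξ : ZMod p, ∏ i ∈ I, |cosMod (ξ * v i)|

lemma charBound_nonneg (v : ι → ZMod p) (I : Finset ι) : 0 ≤ charBound v I :=
  expect_nonneg fun _ _ => prod_nonneg fun _ _ => abs_nonneg _

lemma charBound_anti (v : ι → ZMod p) {I J : Finset ι} (h : I ⊆ J) :
    charBound v J ≤ charBound v I :=
  expect_le_expect fun _ _ =>
    prod_le_prod_of_subset_of_le_one h (fun _ _ => abs_nonneg _)
      (fun _ _ _ => abs_cosMod_le_one _)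

/-- Littlewood–Offord probabilities are at most `charBound`. -/
lemma pr_sgn_sum_eq_le [Fintype ι] [DecidableEq ι] (v : ι → ZMod p) (a : ZMod p) :
    pr (fun x : ι → Bool => ∑ i, sgn (ZMod p) (x i) * v i = a) ≤ charBound v univ := by
  have h0 : pr (fun x : ι → Bool => ∑ i, sgn (ZMod p) (x i) * v i = a) =
      pr (fun x : ι → Bool => ∑ i, sgn (ZMod p) (x i) * v i - a = 0) :=
    pr_congr fun x => sub_eq_zero.symm
  have h1 : (pr (fun x : ι → Bool => ∑ i, sgn (ZMod p) (x i) * v i = a) : ℂ) =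
      𝔼 ξ : ZMod p, ZMod.stdAddChar (-(ξ * a)) * ∏ i, (cosMod (ξ * v i) : ℂ) := by
    rw [h0, pr_eq_zero_eq_expect]
    refine expect_congr rfl fun ξ _ => ?_
    have : ∀ i, (cosMod (ξ * v i) : ℂ) =
        𝔼 b : Bool, ZMod.stdAddChar (ξ * (sgn (ZMod p) b * v i)) := fun i => by
      rw [← expect_stdAddChar_sgn]
      refine expect_congr rfl fun b _ => ?_
      congr 1; ring
    simp only [this]
    rw [← expect_stdAddChar_sum ξ (fun i b => sgn (ZMod p) b * v i), mul_expect]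
    refine expect_congr rfl fun x _ => ?_
    rw [← AddChar.map_add_eq_mul]
    congr 1; ring
  have h2 : pr (fun x : ι → Bool => ∑ i, sgn (ZMod p) (x i) * v i = a) =
      ‖(pr (fun x : ι → Bool => ∑ i, sgn (ZMod p) (x i) * v i = a) : ℂ)‖ := by
    rw [Complex.norm_real, Real.norm_of_nonneg (pr_nonneg _)]
  rw [h2, h1, charBound, Fintype.expect_eq_sum_div_card, Fintype.expect_eq_sum_div_card, norm_div,
    Complex.norm_natCast]
  gcongr
  refine (norm_sum_le _ _).trans (sum_le_sum fun ξ _ => ?_)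
  rw [norm_mul, ZMod.stdAddChar_apply, Circle.norm_coe, one_mul, norm_prod]
  simp

/-- The Littlewood–Offord bound for signs of which only the coordinates in `I` are used. -/
lemma pr_sgn_sum_mem_eq_le [Fintype ι] [DecidableEq ι] (v : ι → ZMod p) (I : Finset ι)
    (a : ZMod p) :
    pr (fun x : ι → Bool => ∑ i ∈ I, sgn (ZMod p) (x i) * v i = a) ≤ charBound v I := by
  have h := pr_sgn_sum_eq_le (fun i => if i ∈ I then v i else 0) a
  have h2 : charBound (fun i => if i ∈ I then v i else 0) univ = charBound v I := by
    unfold charBound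
    refine expect_congr rfl fun ξ _ => ?_
    rw [← prod_subset (subset_univ I)]
    · exact prod_congr rfl fun i hi => by simp [hi]
    · intro i _ hi; simp [hi, cosMod_zero]
  rw [h2] at h
  refine le_trans (le_of_eq (pr_congr fun x => ?_)) h
  simp

end Fourier

/-! ### A Halász-type inequality -/

section Halasz

variable {p : ℕ} [Fact p.Prime] {ι : Type*}

/-- The energy `∑_{i ∈ I} sin² (2πξvᵢ/p)`: a large energy makes `∏ |cos (2πξvᵢ/p)|` small. -/
noncomputable def sinEnergy (v : ι → ZMod p) (I : Finset ι) (ξ : ZMod p) : ℝ :=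
  ∑ i ∈ I, sinMod (ξ * v i) ^ 2

/-- The set of frequencies of energy at most `l`. -/
noncomputable def lowEnergy (v : ι → ZMod p) (I : Finset ι) (l : ℝ) : Finset (ZMod p) :=
  {ξ | sinEnergy v I ξ ≤ l}

lemma mem_lowEnergy {v : ι → ZMod p} {I : Finset ι} {l : ℝ} {ξ : ZMod p} :
    ξ ∈ lowEnergy v I l ↔ sinEnergy v I ξ ≤ l := by simp [lowEnergy]

lemma sinEnergy_nonneg (v : ι → ZMod p) (I : Finset ι) (ξ : ZMod p) : 0 ≤ sinEnergy v I ξ :=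
  sum_nonneg fun _ _ => sq_nonneg _

lemma zero_mem_lowEnergy (v : ι → ZMod p) (I : Finset ι) {l : ℝ} (hl : 0 ≤ l) :
    0 ∈ lowEnergy v I l := by
  simp [mem_lowEnergy, sinEnergy, sinMod_zero, hl]

lemma lowEnergy_mono (v : ι → ZMod p) (I : Finset ι) {l l' : ℝ} (h : l ≤ l') :
    lowEnergy v I l ⊆ lowEnergy v I l' := fun _ hξ =>
  mem_lowEnergy.2 ((mem_lowEnergy.1 hξ).trans h)

lemma sinEnergy_add_le (v : ι → ZMod p) (I : Finset ι) (ξ η : ZMod p) :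
    sinEnergy v I (ξ + η) ≤ 2 * (sinEnergy v I ξ + sinEnergy v I η) := by
  unfold sinEnergy
  rw [← sum_add_distrib, mul_sum]
  refine sum_le_sum fun i _ => ?_
  rw [add_mul]
  exact sinMod_add_sq_le _ _

lemma prod_abs_cosMod_le_exp (v : ι → ZMod p) (I : Finset ι) (ξ : ZMod p) :
    ∏ i ∈ I, |cosMod (ξ * v i)| ≤ Real.exp (-(sinEnergy v I ξ / 2)) := by
  have h : ∀ t : ZMod p, |cosMod t| ≤ Real.exp (-(sinMod t ^ 2 / 2)) := fun t => by
    refine abs_le_of_sq_le_sq ?_ (Real.exp_pos _).le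
    rw [← Real.exp_nat_mul]
    refine le_trans ?_ (Real.add_one_le_exp _)
    push_cast
    linarith [cosMod_sq_add_sinMod_sq t]
  calc ∏ i ∈ I, |cosMod (ξ * v i)| ≤ ∏ i ∈ I, Real.exp (-(sinMod (ξ * v i) ^ 2 / 2)) :=
        prod_le_prod (fun _ _ => abs_nonneg _) fun _ _ => h _
    _ = _ := by rw [← Real.exp_sum, sum_neg_distrib, ← sum_div, sinEnergy]

lemma two_ne_zero_zmod (hp2 : p ≠ 2) : (2 : ZMod p) ≠ 0 := by
  intro h
  have h2 : ((2 : ℕ) : ZMod p) = 0 := by exact_mod_cast h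
  rw [ZMod.natCast_eq_zero_iff] at h2
  exact hp2 ((Nat.prime_dvd_prime_iff_eq Fact.out Nat.prime_two).1 h2)

/-- The energy averages to `|I| / 2`. -/
lemma expect_sinEnergy (hp2 : p ≠ 2) {v : ι → ZMod p} {I : Finset ι} (hv : ∀ i ∈ I, v i ≠ 0) :
    𝔼 ξ : ZMod p, sinEnergy v I ξ = (#I : ℝ) / 2 := by
  unfold sinEnergy
  rw [expect_sum_comm, card_eq_sum_ones, Nat.cast_sum, sum_div]
  refine sum_congr rfl fun i hi => ?_
  have h1 : ∀ ξ : ZMod p, sinMod (ξ * v i) ^ 2 = 1 / 2 - cosMod (ξ * (2 * v i)) / 2 := fun ξ => by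
    rw [show ξ * (2 * v i) = 2 * (ξ * v i) by ring, cosMod_two_mul]; ring
  simp only [h1]
  rw [expect_sub_distrib, ← expect_div _ (fun ξ : ZMod p => cosMod (ξ * (2 * v i))),
    expect_cosMod_mul (mul_ne_zero (two_ne_zero_zmod hp2) (hv i hi)), Fintype.expect_const]
  simp

lemma lowEnergy_ne_univ (hp2 : p ≠ 2) {v : ι → ZMod p} {I : Finset ι} (hv : ∀ i ∈ I, v i ≠ 0)
    {l : ℝ} (hl : l < (#I : ℝ) / 2) : lowEnergy v I l ≠ univ := by
  intro h
  rw [← expect_sinEnergy hp2 hv] at hl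
  refine absurd (expect_le univ_nonempty fun ξ _ => ?_) (not_le.2 hl)
  exact mem_lowEnergy.1 (h ▸ mem_univ ξ)

/-- By the Cauchy–Davenport theorem, quadrupling the energy level at least doubles the number
of nonzero frequencies below it. -/
lemma two_mul_card_lowEnergy_le (v : ι → ZMod p) (I : Finset ι) {l : ℝ} (hl : 0 ≤ l)
    (h : lowEnergy v I (4 * l) ≠ univ) :
    2 * (#(lowEnergy v I l) - 1 : ℝ) ≤ #(lowEnergy v I (4 * l)) - 1 := by
  have hne : (lowEnergy v I l).Nonempty := ⟨0, zero_mem_lowEnergy v I hl⟩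
  open scoped Pointwise in
  have hsub : lowEnergy v I l + lowEnergy v I l ⊆ lowEnergy v I (4 * l) := by
    intro x hx
    obtain ⟨a, ha, b, hb, rfl⟩ := mem_add.1 hx
    rw [mem_lowEnergy] at *
    linarith [sinEnergy_add_le v I a b]
  have hcd := ZMod.cauchy_davenport (p := p) Fact.out hne hne
  have hle := hcd.trans (card_le_card hsub)
  have hlt : #(lowEnergy v I (4 * l)) < p := by
    by_contra hc
    refine h (eq_univ_of_card _ ?_)
    rw [ZMod.card]
    exact le_antisymm ((card_le_univ _).trans_eq (ZMod.card p)) (not_lt.1 hc)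
  have h1 : #(lowEnergy v I l) + #(lowEnergy v I l) - 1 ≤ #(lowEnergy v I (4 * l)) := by omega
  have h2 : 1 ≤ #(lowEnergy v I l) := hne.card_pos
  have h3 : #(lowEnergy v I l) + #(lowEnergy v I l) ≤ #(lowEnergy v I (4 * l)) + 1 := by omega
  have h4 : (#(lowEnergy v I l) + #(lowEnergy v I l) : ℝ) ≤ #(lowEnergy v I (4 * l)) + 1 := by
    exact_mod_cast h3
  linarith

lemma two_pow_mul_card_lowEnergy_le (v : ι → ZMod p) (I : Finset ι) (r : ℕ) {l : ℝ} (hl : 0 ≤ l)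
    (h : lowEnergy v I (4 ^ r * l) ≠ univ) :
    2 ^ r * (#(lowEnergy v I l) - 1 : ℝ) ≤ #(lowEnergy v I (4 ^ r * l)) - 1 := by
  induction r generalizing l with
  | zero => simp
  | succ r ih =>
    have e : (4 : ℝ) ^ (r + 1) * l = 4 ^ r * (4 * l) := by ring
    rw [e] at h ⊢
    have hne : lowEnergy v I (4 * l) ≠ univ := fun h' => h <| univ_subset_iff.1 <|
      h' ▸ lowEnergy_mono v I (le_mul_of_one_le_left (by positivity) (one_le_pow₀ (by norm_num)))
    have h1 := two_mul_card_lowEnergy_le v I hl hne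
    have h2 := ih (by positivity : 0 ≤ 4 * l) h
    calc (2 : ℝ) ^ (r + 1) * (#(lowEnergy v I l) - 1)
        = 2 ^ r * (2 * (#(lowEnergy v I l) - 1)) := by ring
      _ ≤ 2 ^ r * (#(lowEnergy v I (4 * l)) - 1) := by gcongr
      _ ≤ _ := h2

/-- The signed sum `∑ₜ εₜ v_{jₜ}` of the sequence `c` of pairs `(εₜ, jₜ)`. -/
def signedSum {k : ℕ} (v : ι → ZMod p) {I : Finset ι} (c : Fin k → Bool × I) : ZMod p :=
  ∑ t, sgn (ZMod p) (c t).1 * v (c t).2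

/-- The probability that a signed sum of `2k` uniformly chosen entries of `v` with index in `I`
vanishes. -/
noncomputable def zeroProb (k : ℕ) (v : ι → ZMod p) (I : Finset ι) : ℝ :=
  pr fun c : Fin (2 * k) → Bool × I => signedSum v c = 0

lemma zeroProb_eq (hp2 : p ≠ 2) (k : ℕ) (v : ι → ZMod p) {I : Finset ι} (hI : I.Nonempty) :
    zeroProb k v I = 𝔼 ξ : ZMod p, (1 - 2 * sinEnergy v I ξ / #I) ^ (2 * k) := by
  have hmean : ∀ ξ : ZMod p, 𝔼 a : Bool × I,
      (ZMod.stdAddChar (ξ * (sgn (ZMod p) a.1 * v a.2)) : ℂ) =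
        ((𝔼 i : I, cosMod (ξ * v i) : ℝ) : ℂ) := fun ξ => by
    rw [← univ_product_univ, expect_product, expect_comm]
    rw [Fintype.expect_eq_sum_div_card, Fintype.expect_eq_sum_div_card]
    push_cast
    congr 1
    refine sum_congr rfl fun i _ => ?_
    rw [← expect_stdAddChar_sgn]
    refine expect_congr rfl fun b _ => ?_
    congr 1; ring
  have h1 : (zeroProb k v I : ℂ) =
      ((𝔼 ξ : ZMod p, (𝔼 i : I, cosMod (ξ * v i)) ^ (2 * k) : ℝ) : ℂ) := by
    unfold zeroProb
    rw [pr_eq_zero_eq_expect, Fintype.expect_eq_sum_div_card, Fintype.expect_eq_sum_div_card]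
    push_cast
    congr 1
    refine sum_congr rfl fun ξ _ => ?_
    have h := expect_stdAddChar_sum ξ
      (fun (_ : Fin (2 * k)) (a : Bool × I) => sgn (ZMod p) a.1 * v a.2)
    simp only [hmean, prod_const, card_univ, Fintype.card_fin] at h
    exact_mod_cast h
  have h2 : zeroProb k v I = 𝔼 ξ : ZMod p, (𝔼 i : I, cosMod (ξ * v i)) ^ (2 * k) := by
    exact_mod_cast h1
  rw [h2]
  symm
  -- Substituting `2ξ` for `ξ` turns cosines into energies.
  refine Fintype.expect_equiv (Equiv.mulLeft₀ 2 (two_ne_zero_zmod hp2)) _ _ fun ξ => ?_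
  congr 1
  rw [Fintype.expect_eq_sum_div_card, Fintype.card_coe]
  simp only [Equiv.mulLeft₀_apply, mul_assoc, cosMod_two_mul]
  have hc : (#I : ℝ) ≠ 0 := by exact_mod_cast hI.card_pos.ne'
  rw [sum_coe_sort I (fun i => 1 - 2 * sinMod (ξ * v i) ^ 2), sum_sub_distrib, ← mul_sum, sub_div]
  simp [sinEnergy, hc]

/-- Frequencies of low energy make the zero probability large. -/
lemma card_lowEnergy_le_zeroProb (hp2 : p ≠ 2) {k : ℕ} (hk : 0 < k) (v : ι → ZMod p)
    {I : Finset ι} (hI : I.Nonempty) {l : ℝ} (hl : l * (8 * k) ≤ #I) :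
    (#(lowEnergy v I l) : ℝ) / p ≤ 2 * zeroProb k v I := by
  have hc : (0 : ℝ) < #I := by exact_mod_cast hI.card_pos
  have hk' : (0 : ℝ) < k := by exact_mod_cast hk
  have hp0 : (0 : ℝ) < p := by exact_mod_cast (Fact.out : p.Prime).pos
  rw [zeroProb_eq hp2 k v hI, Fintype.expect_eq_sum_div_card, ZMod.card, mul_div_assoc']
  gcongr
  rw [mul_sum, card_eq_sum_ones, Nat.cast_sum]
  refine (sum_le_sum fun ξ hξ => ?_).trans (sum_le_univ_sum_of_nonneg
    (f := fun ξ : ZMod p => 2 * (1 - 2 * sinEnergy v I ξ / #I) ^ (2 * k)) fun ξ => by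
      have := (even_two_mul k).pow_nonneg (1 - 2 * sinEnergy v I ξ / #I); positivity)
  have h1 : 2 * sinEnergy v I ξ / #I ≤ 1 / (4 * k) := by
    rw [div_le_div_iff₀ hc (by positivity)]
    nlinarith [mem_lowEnergy.1 hξ]
  have h0 : 0 ≤ 2 * sinEnergy v I ξ / #I := by
    have := sinEnergy_nonneg v I ξ; positivity
  have h4 : 1 / (4 * (k : ℝ)) ≤ 1 := by
    rw [div_le_one (by positivity)]
    have : (1 : ℝ) ≤ k := by exact_mod_cast hk
    linarith
  have h2 : (1 : ℝ) / 2 ≤ (1 - 2 * sinEnergy v I ξ / #I) ^ (2 * k) := by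
    refine le_trans ?_ (one_add_mul_le_pow (a := -(2 * sinEnergy v I ξ / #I))
      (by linarith) (2 * k) |>.trans_eq (by ring))
    have h3 : ((2 * k : ℕ) : ℝ) * (2 * sinEnergy v I ξ / #I) ≤ 1 / 2 := by
      calc ((2 * k : ℕ) : ℝ) * (2 * sinEnergy v I ξ / #I) ≤ (2 * k : ℕ) * (1 / (4 * k)) := by
            gcongr
        _ = 1 / 2 := by push_cast; field_simp; norm_num
    linarith
  push_cast
  linarith

/-- A Halász-type inequality: the concentration bound `charBound` beats the zero probability of a
short random signed sum by the factor `2 ^ r`, up to an error `2 / p`. -/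
theorem charBound_le_zeroProb (hp2 : p ≠ 2) {v : ι → ZMod p} {I : Finset ι} (hI : I.Nonempty)
    (hv : ∀ i ∈ I, v i ≠ 0) {k r : ℕ} (hk : 0 < k) {l : ℝ} (hl : 0 ≤ l)
    (hlI : 4 ^ r * l * (8 * k) ≤ #I) (hpl : (p : ℝ) ≤ Real.exp (l / 2)) :
    charBound v I ≤ 2 / p + 2 * zeroProb k v I / 2 ^ r := by
  have hc : (0 : ℝ) < #I := by exact_mod_cast hI.card_pos
  have hk' : (1 : ℝ) ≤ k := by exact_mod_cast hk
  have hp0 : (0 : ℝ) < p := by exact_mod_cast (Fact.out : p.Prime).pos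
  have hl4 : (0 : ℝ) ≤ 4 ^ r * l := by positivity
  have hne : lowEnergy v I (4 ^ r * l) ≠ univ := lowEnergy_ne_univ hp2 hv (by nlinarith)
  have h1 := two_pow_mul_card_lowEnergy_le v I r hl hne
  have h2 := card_lowEnergy_le_zeroProb hp2 hk v hI hlI
  have h3 : charBound v I ≤ #(lowEnergy v I l) / p + 1 / p := by
    have hterm : ∀ ξ : ZMod p, ∏ i ∈ I, |cosMod (ξ * v i)| ≤
        (if ξ ∈ lowEnergy v I l then 1 else 0) + 1 / p := fun ξ => by
      split_ifs with h
      · have := prod_le_one (s := I) (f := fun i => |cosMod (ξ * v i)|)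
          (fun _ _ => abs_nonneg _) (fun _ _ => abs_cosMod_le_one _)
        have : (0 : ℝ) ≤ 1 / p := by positivity
        linarith
      · rw [mem_lowEnergy, not_le] at h
        refine (prod_abs_cosMod_le_exp v I ξ).trans ?_
        rw [zero_add, Real.exp_neg, one_div]
        gcongr
        exact hpl.trans (Real.exp_le_exp.2 (by linarith))
    refine (expect_le_expect fun ξ _ => hterm ξ).trans_eq ?_
    rw [expect_add_distrib, Fintype.expect_const, Fintype.expect_eq_sum_div_card, ZMod.card]
    simp
  have h4 : (#(lowEnergy v I l) : ℝ) ≤ 1 + #(lowEnergy v I (4 ^ r * l)) / 2 ^ r := by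
    have : (0 : ℝ) < 2 ^ r := by positivity
    rw [← sub_le_iff_le_add', le_div_iff₀ this]
    linarith
  calc charBound v I ≤ #(lowEnergy v I l) / p + 1 / p := h3
    _ ≤ (1 + #(lowEnergy v I (4 ^ r * l)) / 2 ^ r) / p + 1 / p := by gcongr
    _ = 2 / p + (#(lowEnergy v I (4 ^ r * l)) / p) / 2 ^ r := by ring
    _ ≤ 2 / p + (2 * zeroProb k v I) / 2 ^ r := by gcongr
    _ = _ := by ring

/-- Some index is used exactly once by the sequence `c` of signed indices. -/
def HasUniqueIndex {k : ℕ} {I : Finset ι} (c : Fin k → Bool × I) : Prop :=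
  ∃ t, ∀ t', (c t').2 = (c t).2 → t' = t

/-- The probability that a signed sum of `2k` uniformly chosen entries of `v` with index in `I`
vanishes and uses some index exactly once, so that it determines the entry at this index. -/
noncomputable def goodProb (k : ℕ) (v : ι → ZMod p) (I : Finset ι) : ℝ :=
  pr fun c : Fin (2 * k) → Bool × I => HasUniqueIndex c ∧ signedSum v c = 0

/-- If no index is used exactly once, then at most `k` distinct indices occur in the `2k` positions,
so the sequence of indices factors through `Fin k`. -/
lemma pr_not_hasUniqueIndex_le {k : ℕ} (hk : 0 < k) {I : Finset ι} (hI : I.Nonempty) :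
    pr (fun c : Fin (2 * k) → Bool × I => ¬ HasUniqueIndex c) ≤ ((k : ℝ) ^ 2 / #I) ^ k := by
  classical
  have hfac : ∀ c : Fin (2 * k) → Bool × I, ¬ HasUniqueIndex c →
      ∃ gh ∈ (univ : Finset ((Fin k → I) × (Fin (2 * k) → Fin k))),
        ∀ t, (c t).2 = gh.1 (gh.2 t) := by
    intro c hc
    set A : Finset I := univ.image fun t => (c t).2 with hA
    have hcard : 2 * #A ≤ #(univ : Finset (Fin (2 * k))) := by
      refine mul_card_image_le_card _ _ fun a ha => ?_
      obtain ⟨t, -, rfl⟩ := mem_image.1 ha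
      by_contra hlt
      refine hc ⟨t, fun t' ht' => ?_⟩
      have h1 : #{x | (c x).2 = (c t).2} ≤ 1 := by omega
      exact card_le_one.1 h1 _ (by simp [ht']) _ (by simp)
    rw [card_univ, Fintype.card_fin] at hcard
    have hAk : Fintype.card A ≤ Fintype.card (Fin k) := by
      rw [Fintype.card_coe, Fintype.card_fin]; omega
    obtain ⟨e⟩ := Function.Embedding.nonempty_of_card_le hAk
    have hmem : ∀ t, (c t).2 ∈ A := fun t => mem_image_of_mem _ (mem_univ t)
    have : Nonempty A := ⟨⟨_, hmem ⟨0, by omega⟩⟩⟩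
    refine ⟨(fun i => (invFun e i).1, fun t => e ⟨_, hmem t⟩), mem_univ _, fun t => ?_⟩
    simp only [leftInverse_invFun e.injective _]
  have hc : (0 : ℝ) < #I := by exact_mod_cast hI.card_pos
  have hone : ∀ gh : (Fin k → I) × (Fin (2 * k) → Fin k),
      pr (fun c : Fin (2 * k) → Bool × I => ∀ t, (c t).2 = gh.1 (gh.2 t)) =
        (1 / #I : ℝ) ^ (2 * k) := by
    intro gh
    rw [pr_forall (fun t (a : Bool × I) => a.2 = gh.1 (gh.2 t))]
    have : ∀ b : I, pr (fun a : Bool × I => a.2 = b) = 1 / #I := fun b => by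
      rw [pr_prod]
      simp only [Fintype.expect_const]
      rw [pr_eq_card, filter_eq' univ b]
      simp
    simp [this]
  calc pr (fun c : Fin (2 * k) → Bool × I => ¬ HasUniqueIndex c)
      ≤ pr (fun c : Fin (2 * k) → Bool × I =>
          ∃ gh ∈ (univ : Finset ((Fin k → I) × (Fin (2 * k) → Fin k))),
            ∀ t, (c t).2 = gh.1 (gh.2 t)) := pr_mono hfac
    _ ≤ _ := pr_exists_le _ _
    _ = (#I : ℝ) ^ k * (k : ℝ) ^ (2 * k) * (1 / #I) ^ (2 * k) := by
        simp [hone]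
    _ = _ := by
        rw [div_pow, div_pow, one_pow, pow_mul (k : ℝ), two_mul k, pow_add]
        field_simp

lemma zeroProb_le_goodProb {k : ℕ} (hk : 0 < k) (v : ι → ZMod p) {I : Finset ι}
    (hI : I.Nonempty) : zeroProb k v I ≤ goodProb k v I + ((k : ℝ) ^ 2 / #I) ^ k := by
  refine le_trans (pr_mono fun c hc => ?_) ((pr_or_le _ _).trans
    (add_le_add_right (pr_not_hasUniqueIndex_le hk hI) _))
  by_cases h : HasUniqueIndex c
  · exact Or.inl ⟨h, hc⟩
  · exact Or.inr h

end Halasz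

/-! ### Counting vectors with many zero signed sums -/

section Counting

variable {p : ℕ} [Fact p.Prime] {V : Type*}

lemma signedSum_congr {v v' : V → ZMod p} {I : Finset V} (h : ∀ i ∈ I, v i = v' i) {k : ℕ}
    (c : Fin k → Bool × I) : signedSum v c = signedSum v' c :=
  sum_congr rfl fun t _ => by rw [h _ (c t).2.2]

lemma goodProb_congr (k : ℕ) {v v' : V → ZMod p} {I : Finset V} (h : ∀ i ∈ I, v i = v' i) :
    goodProb k v I = goodProb k v' I :=
  pr_congr fun c => by rw [signedSum_congr h]

/-- The least value of `goodProb k v I` over the `s`-element subsets `I` of `S`. -/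
noncomputable def minGoodProb (k s : ℕ) (v : V → ZMod p) (S : Finset V) : ℝ :=
  ⨅ I : {I // I ∈ S.powersetCard s}, goodProb k v I

lemma minGoodProb_nonneg (k s : ℕ) (v : V → ZMod p) (S : Finset V) : 0 ≤ minGoodProb k s v S :=
  Real.iInf_nonneg fun _ => pr_nonneg _

lemma minGoodProb_le {k s : ℕ} (v : V → ZMod p) {S I : Finset V} (hI : I ⊆ S) (hs : #I = s) :
    minGoodProb k s v S ≤ goodProb k v I :=
  ciInf_le (f := fun I : {I // I ∈ S.powersetCard s} => goodProb k v I)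
    (Set.finite_range _).bddBelow ⟨I, mem_powersetCard.2 ⟨hI, hs⟩⟩

lemma exists_goodProb_eq_minGoodProb {k s : ℕ} (v : V → ZMod p) {S : Finset V} (hs : s ≤ #S) :
    ∃ I ⊆ S, #I = s ∧ goodProb k v I = minGoodProb k s v S := by
  obtain ⟨I₀, h₀, hI₀⟩ := exists_subset_card_eq hs
  have : Nonempty {I // I ∈ S.powersetCard s} := ⟨⟨I₀, mem_powersetCard.2 ⟨h₀, hI₀⟩⟩⟩
  obtain ⟨I, hI⟩ := exists_eq_ciInf_of_finite
    (f := fun I : {I // I ∈ S.powersetCard s} => goodProb k v I)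
  exact ⟨I, (mem_powersetCard.1 I.2).1, (mem_powersetCard.1 I.2).2, hI⟩

lemma minGoodProb_le_one {k s : ℕ} (v : V → ZMod p) {S : Finset V} (hs : s ≤ #S) :
    minGoodProb k s v S ≤ 1 := by
  obtain ⟨I, -, -, h⟩ := exists_goodProb_eq_minGoodProb (k := k) v hs
  exact h ▸ pr_le_one _

/-- The entry at an index used exactly once by `c` is determined by `signedSum v c = 0` and the
other entries of `v`. -/
lemma eq_of_signedSum_eq_zero {k : ℕ} {I : Finset V} {c : Fin k → Bool × I} {t : Fin k}
    (ht : ∀ t', (c t').2 = (c t).2 → t' = t) {v v' : V → ZMod p} (hv : signedSum v c = 0)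
    (hv' : signedSum v' c = 0) (h : ∀ i : V, i ≠ (c t).2 → v i = v' i) : v = v' := by
  have h1 : signedSum v c - signedSum v' c =
      sgn (ZMod p) (c t).1 * (v (c t).2 - v' (c t).2) := by
    unfold signedSum
    rw [← sum_sub_distrib, sum_eq_single t, mul_sub]
    · intro t' _ ht'
      rw [h _ fun he => ht' (ht t' (Subtype.ext he)), sub_self]
    · simp
  rw [hv, hv', sub_zero] at h1
  have h2 : v (c t).2 = v' (c t).2 := by
    rw [← sub_eq_zero]
    cases hb : (c t).1 <;> simp only [sgn, hb, cond_true, cond_false] at h1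
    · linear_combination h1
    · linear_combination -h1
  funext i
  by_cases hi : i = ↑(c t).2
  · rw [hi, h2]
  · exact h i hi

variable [Fintype V] [DecidableEq V]

/-- The vectors supported in `K`. -/
def supportedIn (p : ℕ) [Fact p.Prime] (K : Finset V) : Finset (V → ZMod p) :=
  Fintype.piFinset fun i => if i ∈ K then univ else {0}

lemma mem_supportedIn {K : Finset V} {v : V → ZMod p} :
    v ∈ supportedIn p K ↔ ∀ i, i ∉ K → v i = 0 := by
  rw [supportedIn, Fintype.mem_piFinset]
  refine forall_congr' fun i => ?_
  by_cases hi : i ∈ K <;> simp [hi]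

lemma card_supportedIn (K : Finset V) : #(supportedIn p K) = p ^ #K := by
  rw [supportedIn, Fintype.card_piFinset, ← prod_subset (subset_univ K) fun i _ hi => by simp [hi]]
  rw [prod_congr rfl fun i hi => by rw [if_pos hi], prod_const, card_univ, ZMod.card]

/-- The weighted counting bound. Reveal the coordinates in `S` through random constraints: a random
signed sum with index set inside the remaining coordinates vanishes and isolates a coordinate with
probability at least `minGoodProb k s v S`; if it does, this coordinate is determined by the others
and can be removed. After all but `s` coordinates of `S` are removed, only `p ^ s` possibilities
remain on `S`. -/
theorem sum_minGoodProb_pow_le (k s : ℕ) {S K : Finset V} (hSK : S ⊆ K) (hs : s ≤ #S) :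
    ∑ v ∈ supportedIn p K, minGoodProb k s v S ^ (#S - s) ≤ (p : ℝ) ^ (#K - #S + s) := by
  classical
  induction hd : #S - s generalizing S K with
  | zero =>
    have := card_le_card hSK
    simp only [pow_zero, sum_const, card_supportedIn, nsmul_eq_mul, mul_one]
    rw [Nat.cast_pow, show #K - #S + s = #K by omega]
  | succ d ih =>
    obtain ⟨I, hIS, hIs⟩ := exists_subset_card_eq hs
    have hstep : ∀ c : Fin (2 * k) → Bool × I,
        ∑ v ∈ supportedIn p K, minGoodProb k s v S ^ d *
          (if HasUniqueIndex c ∧ signedSum v c = 0 then 1 else 0) ≤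
            (p : ℝ) ^ (#K - #S + s) := by
      intro c
      by_cases hc : HasUniqueIndex c
      swap
      · simp only [hc, false_and, if_false, mul_zero, sum_const_zero]; positivity
      obtain ⟨t, ht⟩ := hc
      have hc : HasUniqueIndex c := ⟨t, ht⟩
      set i : V := ↑(c t).2 with hi
      have hiS : i ∈ S := hIS (c t).2.2
      have hiK : i ∈ K := hSK hiS
      have hcS : #(S.erase i) = #S - 1 := card_erase_of_mem hiS
      have hcK : #(K.erase i) = #K - 1 := card_erase_of_mem hiK
      have hSK' := card_le_card hSK
      have hS0 : 0 < #S := card_pos.2 ⟨i, hiS⟩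
      have hih := ih (erase_subset_erase i hSK) (by omega) (by omega)
      rw [show #(K.erase i) - #(S.erase i) + s = #K - #S + s by omega] at hih
      have hmono : ∀ v : V → ZMod p,
          minGoodProb k s v S ≤ minGoodProb k s (update v i 0) (S.erase i) := fun v => by
        obtain ⟨J, hJ, hJs, hJe⟩ := exists_goodProb_eq_minGoodProb (k := k) (update v i 0)
          (s := s) (S := S.erase i) (by omega)
        rw [← hJe, goodProb_congr k (v' := v)]
        · exact minGoodProb_le v (hJ.trans (erase_subset _ _)) hJs
        · intro j hj
          rw [update_of_ne (ne_of_mem_erase (hJ hj))]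
      calc ∑ v ∈ supportedIn p K, minGoodProb k s v S ^ d *
            (if HasUniqueIndex c ∧ signedSum v c = 0 then 1 else 0)
          = ∑ v ∈ supportedIn p K with signedSum v c = 0, minGoodProb k s v S ^ d := by
            rw [sum_filter]
            refine sum_congr rfl fun v _ => ?_
            by_cases h : signedSum v c = 0 <;> simp [h, hc]
        _ ≤ ∑ v ∈ supportedIn p K with signedSum v c = 0,
              minGoodProb k s (update v i 0) (S.erase i) ^ d :=
            sum_le_sum fun v _ => pow_le_pow_left₀ (minGoodProb_nonneg ..) (hmono v) d
        _ = ∑ v ∈ (supportedIn p K |>.filter fun v => signedSum v c = 0).image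
              (fun v => update v i 0), minGoodProb k s v (S.erase i) ^ d := by
            rw [sum_image]
            intro v hv v' hv' h
            have hv := (mem_filter.1 hv).2
            have hv' := (mem_filter.1 hv').2
            refine eq_of_signedSum_eq_zero ht hv hv' fun j hj => ?_
            have := congrFun h j
            simpa [update_of_ne (show j ≠ i from hj)] using this
        _ ≤ ∑ v ∈ supportedIn p (K.erase i), minGoodProb k s v (S.erase i) ^ d := by
            refine sum_le_sum_of_subset_of_nonneg (fun v hv => ?_)
              fun _ _ _ => pow_nonneg (minGoodProb_nonneg ..) _
            obtain ⟨u, hu, rfl⟩ := mem_image.1 hv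
            have hu := mem_supportedIn.1 (mem_filter.1 hu).1
            refine mem_supportedIn.2 fun j hj => ?_
            by_cases hji : j = i
            · simp [hji]
            · simp only [update_of_ne hji]
              exact hu j fun hjK => hj (mem_erase.2 ⟨hji, hjK⟩)
        _ ≤ _ := hih
    rcases isEmpty_or_nonempty (Fin (2 * k) → Bool × I) with he | he
    · have : ∀ v : V → ZMod p, minGoodProb k s v S = 0 := fun v =>
        le_antisymm ((minGoodProb_le v hIS hIs).trans_eq (by simp [goodProb, pr]))
          (minGoodProb_nonneg ..)
      simp only [this, zero_pow d.succ_ne_zero, sum_const_zero]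
      positivity
    calc ∑ v ∈ supportedIn p K, minGoodProb k s v S ^ (d + 1)
        ≤ ∑ v ∈ supportedIn p K, 𝔼 c : Fin (2 * k) → Bool × I, minGoodProb k s v S ^ d *
          (if HasUniqueIndex c ∧ signedSum v c = 0 then 1 else 0) := by
          refine sum_le_sum fun v _ => ?_
          rw [← mul_expect, pow_succ]
          refine mul_le_mul_of_nonneg_left ?_ (pow_nonneg (minGoodProb_nonneg ..) _)
          refine (minGoodProb_le v hIS hIs).trans_eq ?_
          unfold goodProb pr
          exact expect_congr rfl fun c _ => by congr
      _ = 𝔼 c : Fin (2 * k) → Bool × I, ∑ v ∈ supportedIn p K, minGoodProb k s v S ^ d *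
          (if HasUniqueIndex c ∧ signedSum v c = 0 then 1 else 0) := by
          rw [expect_sum_comm]
      _ ≤ _ := expect_le univ_nonempty fun c _ => hstep c

end Counting

/-! ### Structured vectors are unlikely to solve `M v = w` -/

/-- The symmetric sign matrix with the sign `σ s(i, j)` at the entries `(i, j)` and `(j, i)`. -/
def signMat (R : Type*) [Ring R] {V : Type*} (σ : Sym2 V → Bool) : Matrix V V R :=
  Matrix.of fun i j => sgn R (σ s(i, j))

section Structured

variable {p : ℕ} [Fact p.Prime] {V : Type*} [Fintype V] [DecidableEq V]

lemma sym2_mk_injective (I : Finset V) :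
    Injective fun y : ↥Iᶜ × ↥I => s((y.1 : V), (y.2 : V)) := by
  rintro ⟨i, j⟩ ⟨i', j'⟩ h
  rcases Sym2.eq_iff.1 h with ⟨h1, h2⟩ | ⟨h1, h2⟩
  · exact Prod.ext (Subtype.ext h1) (Subtype.ext h2)
  · exact absurd j'.2 (h1 ▸ mem_compl.1 i.2)

/-- The rows outside `I` have independent entries in the columns of `I`. So the probability that
`M v = w` is at most a power of the concentration of the signed sums of the entries of `v` in
`I`. -/
lemma pr_mulVec_eq_le_of_forall (v w : V → ZMod p) (I : Finset V) {c : ℝ}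
    (hc : ∀ a, pr (fun x : I → Bool => ∑ j, sgn (ZMod p) (x j) * v j = a) ≤ c) :
    pr (fun σ : Sym2 V → Bool => (signMat (ZMod p) σ).mulVec v = w) ≤
      c ^ (Fintype.card V - #I) := by
  refine pr_le_of_extend (sym2_mk_injective I) fun σ => ?_
  set e := fun y : ↥Iᶜ × ↥I => s((y.1 : V), (y.2 : V)) with he
  have hsub : ∀ x : ↥Iᶜ × ↥I → Bool, (signMat (ZMod p) (extend e x σ)).mulVec v = w →
      ∀ i : ↥Iᶜ, ∑ j : I, sgn (ZMod p) (x (i, j)) * v j =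
        w i - ∑ j ∈ Iᶜ, sgn (ZMod p) (σ s((i : V), j)) * v j := by
    rintro x rfl i
    rw [eq_sub_iff_add_eq, Matrix.mulVec, dotProduct, ← sum_add_sum_compl I,
      ← sum_coe_sort I]
    congr 1
    · refine sum_congr rfl fun j _ => ?_
      rw [signMat, Matrix.of_apply, show s((i : V), (j : V)) = e (i, j) from rfl,
        (sym2_mk_injective I).extend_apply]
    · refine sum_congr rfl fun j hj => ?_
      rw [signMat, Matrix.of_apply, extend_apply']
      rintro ⟨⟨a, b⟩, hab⟩
      rcases Sym2.eq_iff.1 hab with ⟨h1, h2⟩ | ⟨h1, h2⟩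
      · exact mem_compl.1 hj (h2 ▸ b.2)
      · exact mem_compl.1 i.2 (h2 ▸ b.2)
  refine (pr_mono hsub).trans ?_
  have h := pr_equiv (Equiv.curry ↥Iᶜ ↥I Bool) (fun y : ↥Iᶜ → ↥I → Bool =>
    ∀ i : ↥Iᶜ, ∑ j : I, sgn (ZMod p) (y i j) * v j =
        w i - ∑ j ∈ Iᶜ, sgn (ZMod p) (σ s((i : V), j)) * v j)
  refine h.le.trans ?_
  rw [pr_forall (fun (i : ↥Iᶜ) (z : ↥I → Bool) => ∑ j : I, sgn (ZMod p) (z j) * v j =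
        w i - ∑ j ∈ Iᶜ, sgn (ZMod p) (σ s((i : V), j)) * v j), ← card_compl]
  refine (prod_le_prod (fun i _ => pr_nonneg _) fun i _ => hc _).trans_eq ?_
  rw [prod_const, card_univ, Fintype.card_coe]

lemma pr_mulVec_eq_le_charBound (v w : V → ZMod p) (I : Finset V) :
    pr (fun σ : Sym2 V → Bool => (signMat (ZMod p) σ).mulVec v = w) ≤
      charBound v I ^ (Fintype.card V - #I) := by
  refine pr_mulVec_eq_le_of_forall v w I fun a => ?_
  refine (pr_sgn_sum_eq_le (fun j : I => v j) a).trans_eq ?_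
  unfold charBound
  exact expect_congr rfl fun ξ _ => prod_coe_sort I fun i => |cosMod (ξ * v i)|

/-- A nonzero vector: condition on everything but the column of a nonzero entry. -/
lemma pr_mulVec_eq_le_half (hp2 : p ≠ 2) {v : V → ZMod p} (hv : v ≠ 0) (w : V → ZMod p) :
    pr (fun σ : Sym2 V → Bool => (signMat (ZMod p) σ).mulVec v = w) ≤
      (1 / 2 : ℝ) ^ (Fintype.card V - 1) := by
  obtain ⟨i, hi⟩ := Function.ne_iff.1 hv
  have h := pr_mulVec_eq_le_of_forall v w {i} (c := 1 / 2) fun a => ?_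
  · simpa using h
  · classical
    rw [pr_eq_card]
    have h1 : #{x : ({i} : Finset V) → Bool | ∑ j, sgn (ZMod p) (x j) * v j = a} ≤ 1 := by
      refine card_le_one.2 fun x hx y hy => ?_
      have hx := (mem_filter.1 hx).2
      have hy := (mem_filter.1 hy).2
      simp only [univ_unique, sum_singleton] at hx hy
      rw [← hy] at hx
      have h3 := mul_right_cancel₀ (by simpa using hi) hx
      have h4 : (1 : ZMod p) ≠ -1 := fun h => two_ne_zero_zmod hp2 (by linear_combination h)
      funext j
      rw [Subsingleton.elim j default]
      revert h3
      cases x default <;> cases y default <;> simp [sgn, h4, h4.symm]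
    have h2 : (#{x : ({i} : Finset V) → Bool | ∑ j, sgn (ZMod p) (x j) * v j = a} : ℝ) ≤ 1 := by
      exact_mod_cast h1
    simp only [Fintype.card_fun, Fintype.card_bool, Fintype.card_coe, card_singleton, pow_one]
    push_cast
    linarith

/-- If `v` is not concentrated at the trivial scale `5 / p`, then some `s` entries of `v` have
both a concentration bound and a zero probability governed by `minGoodProb`. -/
lemma pr_mulVec_eq_le_minGoodProb (hp2 : p ≠ 2) {k : ℕ} (hk : 0 < k) (hpk : p ≤ 2 ^ k)
    {v : V → ZMod p} (w : V → ZMod p) {S J : Finset V} (hSJ : S ⊆ Jᶜ) (hS : 2 ^ 18 * k ^ 2 ≤ #S)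
    (hv : ∀ i ∈ S, v i ≠ 0) (hb : 5 / p < charBound v Jᶜ) :
    pr (fun σ : Sym2 V → Bool => (signMat (ZMod p) σ).mulVec v = w) ≤
      (5 / 128 : ℝ) ^ (Fintype.card V - 2 ^ 18 * k ^ 2) *
        minGoodProb k (2 ^ 18 * k ^ 2) v S ^ (#S - 2 ^ 18 * k ^ 2) := by
  obtain ⟨I, hIS, hIs, hI⟩ := exists_goodProb_eq_minGoodProb (k := k) v hS
  have hI0 : I.Nonempty := card_pos.1 (by rw [hIs]; positivity)
  have hp0 : (0 : ℝ) < p := by exact_mod_cast (Fact.out : p.Prime).pos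
  have hpk' : (p : ℝ) ≤ 2 ^ k := by exact_mod_cast hpk
  have hk' : (0 : ℝ) < k := by exact_mod_cast hk
  have hIs' : (#I : ℝ) = 2 ^ 18 * k ^ 2 := by rw [hIs]; push_cast; ring
  -- The size `2 ^ 18 * k ^ 2 = 4 ^ 7 * (2 * k) * (8 * k)` of `I` allows `r = 7` and `l = 2 * k`.
  have h1 := charBound_le_zeroProb hp2 (k := k) (r := 7) hI0 (fun i hi => hv i (hIS hi)) hk
    (l := 2 * k) (by positivity) (by rw [hIs']; apply le_of_eq; ring) (by
      refine hpk'.trans ?_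
      rw [mul_div_cancel_left₀ _ (two_ne_zero), ← mul_one (k : ℝ), Real.exp_nat_mul]
      exact pow_le_pow_left₀ (by norm_num) (by linarith [Real.add_one_le_exp (1 : ℝ)]) k)
  have h2 := zeroProb_le_goodProb hk v hI0
  have h3 : ((k : ℝ) ^ 2 / #I) ^ k ≤ 1 / p := by
    have : (k : ℝ) ^ 2 / #I = 1 / 2 ^ 18 := by rw [hIs']; field_simp
    rw [this]
    calc (1 / 2 ^ 18 : ℝ) ^ k ≤ (1 / 2) ^ k := by
          apply pow_le_pow_left₀ <;> norm_num
      _ = 1 / 2 ^ k := by rw [one_div_pow]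
      _ ≤ 1 / p := by gcongr
  have h4 : charBound v Jᶜ ≤ charBound v I := charBound_anti v (hIS.trans hSJ)
  have h5 : charBound v I ≤ 5 / 128 * minGoodProb k (2 ^ 18 * k ^ 2) v S := by
    rw [← hI]
    have e1 : (5 : ℝ) / p = 5 * (1 / p) := by ring
    have e2 : (2 : ℝ) / p = 2 * (1 / p) := by ring
    have e3 : (0 : ℝ) < 1 / p := by positivity
    rw [e1] at hb
    rw [e2] at h1
    linarith
  have hSV : #S ≤ Fintype.card V := card_le_univ S
  calc _ ≤ charBound v I ^ (Fintype.card V - #I) := pr_mulVec_eq_le_charBound v w I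
    _ ≤ (5 / 128 * minGoodProb k (2 ^ 18 * k ^ 2) v S) ^ (Fintype.card V - #I) :=
        pow_le_pow_left₀ (charBound_nonneg _ _) h5 _
    _ ≤ _ := by
        rw [mul_pow, hIs]
        refine mul_le_mul_of_nonneg_left ?_ (by positivity)
        exact pow_le_pow_of_le_one (minGoodProb_nonneg ..) (minGoodProb_le_one v hS) (by omega)

/-- Up to an exponentially small probability, every nonzero solution of `M v = w` is unstructured,
even after the few coordinates in `J` are discarded. -/
theorem pr_exists_structured_le (hp2 : p ≠ 2) {k : ℕ} (hk : 0 < k) (hpk : p ≤ 2 ^ k)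
    (hVk : Fintype.card V ≤ 2 ^ k) (hkV : 2 ^ 22 * k ^ 3 ≤ Fintype.card V) (w : V → ZMod p)
    {J : Finset V} (hJ : #J ≤ k) :
    pr (fun σ : Sym2 V → Bool => ∃ v : V → ZMod p, v ≠ 0 ∧ (signMat (ZMod p) σ).mulVec v = w ∧
      5 / p < charBound v Jᶜ) ≤ (1 / 2) ^ k := by
  classical
  set N := Fintype.card V with hN
  set s := 2 ^ 18 * k ^ 2 with hs
  have hp0 : (0 : ℝ) < p := by exact_mod_cast (Fact.out : p.Prime).pos
  have hp1 : (1 : ℝ) ≤ p := by exact_mod_cast (Fact.out : p.Prime).one_lt.le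
  have hpk' : (p : ℝ) ≤ 2 ^ k := by exact_mod_cast hpk
  have hk1 : k ≤ k ^ 3 := Nat.le_self_pow (by norm_num) k
  have hk2 : k ^ 2 ≤ k ^ 3 := Nat.pow_le_pow_right hk (by norm_num)
  have hk3 : k * (s + k) = 2 ^ 18 * k ^ 3 + k ^ 2 := by rw [hs]; ring
  have hrN : s + k ≤ N := by omega
  -- Nonzero vectors with fewer than `s` nonzero entries outside `J`.
  set A : Finset (V → ZMod p) :=
    ((powersetCard (s + k) univ).biUnion fun K => supportedIn p K).filter (· ≠ 0) with hA
  have hAcard : (#A : ℝ) ≤ 2 ^ (2 * (k * (s + k))) := by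
    have h1 : #A ≤ N ^ (s + k) * p ^ (s + k) := by
      refine (card_filter_le _ _).trans (card_biUnion_le.trans ?_)
      rw [sum_congr rfl fun K hK => by
        rw [card_supportedIn, (mem_powersetCard.1 hK).2], sum_const, card_powersetCard, card_univ,
        smul_eq_mul]
      exact Nat.mul_le_mul_right _ (Nat.choose_le_pow _ _)
    have h2 : #A ≤ 2 ^ (2 * (k * (s + k))) := by
      rw [two_mul, pow_add, pow_mul 2 k]
      exact h1.trans (Nat.mul_le_mul (Nat.pow_le_pow_left hVk _) (Nat.pow_le_pow_left hpk _))
    exact_mod_cast h2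
  have hsparse : ∑ v ∈ A, pr (fun σ : Sym2 V → Bool => (signMat (ZMod p) σ).mulVec v = w) ≤
      (1 / 2) ^ (k + 1) := by
    calc ∑ v ∈ A, pr (fun σ : Sym2 V → Bool => (signMat (ZMod p) σ).mulVec v = w)
        ≤ #A • (1 / 2 : ℝ) ^ (N - 1) :=
          sum_le_card_nsmul _ _ _ fun v hv => pr_mulVec_eq_le_half hp2 (mem_filter.1 hv).2 w
      _ ≤ 2 ^ (2 * (k * (s + k))) * (1 / 2 : ℝ) ^ (N - 1) := by
          rw [nsmul_eq_mul]; gcongr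
      _ ≤ 2 ^ (2 * (k * (s + k))) * (1 / 2 : ℝ) ^ (2 * (k * (s + k)) + (k + 1)) := by
          gcongr 2 ^ (2 * (k * (s + k))) * ?_
          exact pow_le_pow_of_le_one (by norm_num) (by norm_num) (by omega)
      _ = _ := by rw [pow_add, ← mul_assoc, ← mul_pow]; norm_num
  -- Vectors whose set of nonzero entries outside `J` is `S`, with `s ≤ #S`.
  set B : Finset V → Finset (V → ZMod p) := fun S =>
    (supportedIn p (S ∪ J)).filter fun v => (∀ i ∈ S, v i ≠ 0) ∧ 5 / p < charBound v Jᶜ with hB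
  have hdense : ∀ S ∈ (univ : Finset (Finset V)).filter (fun S => S ⊆ Jᶜ ∧ s ≤ #S),
      ∑ v ∈ B S, pr (fun σ : Sym2 V → Bool => (signMat (ZMod p) σ).mulVec v = w) ≤
        (1 / 2) ^ (N + k + 1) := by
    intro S hS
    obtain ⟨hSJ, hsS⟩ := (mem_filter.1 hS).2
    calc ∑ v ∈ B S, pr (fun σ : Sym2 V → Bool => (signMat (ZMod p) σ).mulVec v = w)
        ≤ ∑ v ∈ B S, (5 / 128 : ℝ) ^ (N - s) * minGoodProb k s v S ^ (#S - s) :=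
          sum_le_sum fun v hv => pr_mulVec_eq_le_minGoodProb hp2 hk hpk w hSJ hsS
            (mem_filter.1 hv).2.1 (mem_filter.1 hv).2.2
      _ ≤ ∑ v ∈ supportedIn p (S ∪ J),
            (5 / 128 : ℝ) ^ (N - s) * minGoodProb k s v S ^ (#S - s) :=
          sum_le_sum_of_subset_of_nonneg (filter_subset _ _) fun v _ _ =>
            mul_nonneg (by positivity) (pow_nonneg (minGoodProb_nonneg ..) _)
      _ ≤ (1 / 2 : ℝ) ^ (4 * (N - s)) * 2 ^ (k * (s + k)) := by
          rw [← mul_sum]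
          refine mul_le_mul ?_ ?_ (sum_nonneg fun v _ => pow_nonneg (minGoodProb_nonneg ..) _)
            (by positivity)
          -- The gain `5 / 128 ≤ 2 ^ (-4)` per row outweighs the `2 ^ N` choices of `S`.
          · rw [pow_mul]
            apply pow_le_pow_left₀ <;> norm_num
          · refine (sum_minGoodProb_pow_le k s subset_union_left hsS).trans ?_
            have := card_union_le S J
            rw [pow_mul]
            calc (p : ℝ) ^ (#(S ∪ J) - #S + s) ≤ (p : ℝ) ^ (s + k) :=
                  pow_le_pow_right₀ hp1 (by omega)
              _ ≤ _ := by gcongr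
      _ ≤ (1 / 2 : ℝ) ^ (k * (s + k) + (N + k + 1)) * 2 ^ (k * (s + k)) := by
          refine mul_le_mul_of_nonneg_right ?_ (by positivity)
          exact pow_le_pow_of_le_one (by norm_num) (by norm_num) (by omega)
      _ = _ := by rw [pow_add, mul_right_comm, ← mul_pow]; norm_num
  have hcover : ∀ σ : Sym2 V → Bool, (∃ v : V → ZMod p, v ≠ 0 ∧
      (signMat (ZMod p) σ).mulVec v = w ∧ 5 / p < charBound v Jᶜ) →
      (∃ v ∈ A, (signMat (ZMod p) σ).mulVec v = w) ∨
      ∃ S ∈ (univ : Finset (Finset V)).filter (fun S => S ⊆ Jᶜ ∧ s ≤ #S),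
        ∃ v ∈ B S, (signMat (ZMod p) σ).mulVec v = w := by
    rintro σ ⟨v, hv0, hv, hb⟩
    set S : Finset V := Jᶜ.filter (fun i => v i ≠ 0) with hS
    have hsupp : v ∈ supportedIn p (S ∪ J) := mem_supportedIn.2 fun i hi => by
      by_contra h
      rw [mem_union, not_or] at hi
      exact hi.1 (mem_filter.2 ⟨mem_compl.2 hi.2, h⟩)
    rcases lt_or_ge #S s with h | h
    · left
      obtain ⟨K, hK, -, hKc⟩ := exists_subsuperset_card_eq (subset_univ (S ∪ J))
        (n := s + k) ((card_union_le S J).trans (by omega)) (by rw [card_univ]; exact hrN)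
      refine ⟨v, mem_filter.2 ⟨mem_biUnion.2 ⟨K, mem_powersetCard.2 ⟨subset_univ _, hKc⟩, ?_⟩,
        hv0⟩, hv⟩
      exact mem_supportedIn.2 fun i hi => mem_supportedIn.1 hsupp i fun h => hi (hK h)
    · right
      exact ⟨S, mem_filter.2 ⟨mem_univ _, filter_subset _ _, h⟩, v,
        mem_filter.2 ⟨hsupp, fun i hi => (mem_filter.1 hi).2, hb⟩, hv⟩
  refine (pr_mono hcover).trans ((pr_or_le _ _).trans ?_)
  have h1 := (pr_exists_le A fun v (σ : Sym2 V → Bool) =>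
    (signMat (ZMod p) σ).mulVec v = w).trans hsparse
  have h2 : pr (fun σ : Sym2 V → Bool =>
      ∃ S ∈ (univ : Finset (Finset V)).filter (fun S => S ⊆ Jᶜ ∧ s ≤ #S),
        ∃ v ∈ B S, (signMat (ZMod p) σ).mulVec v = w) ≤ (1 / 2) ^ (k + 1) := by
    refine (pr_exists_le _ _).trans ((sum_le_sum fun S hS =>
      (pr_exists_le _ _).trans (hdense S hS)).trans ?_)
    rw [sum_const, nsmul_eq_mul]
    have hc : (#((univ : Finset (Finset V)).filter fun S => S ⊆ Jᶜ ∧ s ≤ #S) : ℝ) ≤ 2 ^ N := by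
      have := card_filter_le (univ : Finset (Finset V)) (fun S => S ⊆ Jᶜ ∧ s ≤ #S)
      rw [card_univ, Fintype.card_finset] at this
      exact_mod_cast this
    calc _ ≤ (2 : ℝ) ^ N * (1 / 2) ^ (N + k + 1) := by gcongr
      _ = _ := by rw [add_assoc, pow_add, ← mul_assoc, ← mul_pow]; norm_num
  calc _ ≤ (1 / 2 : ℝ) ^ (k + 1) + (1 / 2) ^ (k + 1) := add_le_add h1 h2
    _ = _ := by rw [pow_succ]; ring

end Structured

/-! ### The corank of a growing symmetric matrix -/

section Corank

variable {F : Type*} [Field F] {m : ℕ}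

/-- The dimension of the kernel of a square matrix. -/
noncomputable def corank {V : Type*} [Fintype V] (M : Matrix V V F) : ℕ :=
  Module.finrank F (LinearMap.ker M.mulVecLin)

lemma corank_pos_iff {V : Type*} [Fintype V] {M : Matrix V V F} :
    0 < corank M ↔ ∃ v, v ≠ 0 ∧ M.mulVec v = 0 := by
  rw [corank, Module.finrank_pos_iff_exists_ne_zero]
  constructor
  · rintro ⟨⟨v, hv⟩, h⟩
    exact ⟨v, fun h0 => h (Subtype.ext h0), hv⟩
  · rintro ⟨v, h, hv⟩
    exact ⟨⟨v, hv⟩, fun h0 => h (congrArg Subtype.val h0)⟩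

lemma corank_pos_iff_det {V : Type*} [Fintype V] [DecidableEq V] {M : Matrix V V F} :
    0 < corank M ↔ M.det = 0 := by
  rw [corank_pos_iff, ← Matrix.exists_mulVec_eq_zero_iff]

lemma corank_le_card {V : Type*} [Fintype V] (M : Matrix V V F) : corank M ≤ Fintype.card V :=
  (Submodule.finrank_le _).trans_eq (Module.finrank_fintype_fun_eq_card F)

/-- The leading principal submatrix with one row and column less. -/
def leading (M : Matrix (Fin (m + 1)) (Fin (m + 1)) F) : Matrix (Fin m) (Fin m) F :=
  M.submatrix Fin.castSucc Fin.castSucc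

lemma mulVec_castSucc (M : Matrix (Fin (m + 1)) (Fin (m + 1)) F) (v : Fin (m + 1) → F)
    (i : Fin m) : M.mulVec v i.castSucc =
      (leading M).mulVec (fun j => v j.castSucc) i +
        M i.castSucc (Fin.last m) * v (Fin.last m) := by
  simp [Matrix.mulVec, dotProduct, Fin.sum_univ_castSucc, leading]

lemma mulVec_last (M : Matrix (Fin (m + 1)) (Fin (m + 1)) F) (v : Fin (m + 1) → F) :
    M.mulVec v (Fin.last m) = ∑ j : Fin m, M (Fin.last m) j.castSucc * v j.castSucc +
      M (Fin.last m) (Fin.last m) * v (Fin.last m) := by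
  simp [Matrix.mulVec, dotProduct, Fin.sum_univ_castSucc]

/-- Adding a row and a column to a nonsingular matrix makes the corank at most one. -/
lemma corank_le_one_of_leading (M : Matrix (Fin (m + 1)) (Fin (m + 1)) F)
    (h : corank (leading M) = 0) : corank M ≤ 1 := by
  let f : LinearMap.ker M.mulVecLin →ₗ[F] F :=
    (LinearMap.proj (Fin.last m)).domRestrict _
  have hf : Injective f := by
    rw [← LinearMap.ker_eq_bot, LinearMap.ker_eq_bot']
    rintro ⟨v, hv⟩ hvl
    have hvl : v (Fin.last m) = 0 := hvl
    have hv : M.mulVec v = 0 := hv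
    have h1 : (leading M).mulVec (fun j => v j.castSucc) = 0 := by
      funext i
      have := mulVec_castSucc M v i
      rw [hv, hvl, mul_zero, add_zero] at this
      exact this.symm
    have h2 : (fun j : Fin m => v j.castSucc) = 0 := by
      by_contra hne
      exact absurd (corank_pos_iff.2 ⟨_, hne, h1⟩) (by omega)
    refine Subtype.ext (funext fun i => ?_)
    refine Fin.lastCases hvl (fun j => ?_) i
    exact congrFun h2 j
  calc corank M ≤ Module.finrank F F := LinearMap.finrank_le_finrank_of_injective hf
    _ = 1 := Module.finrank_self F

/-- If the new column is not orthogonal to the kernel, the corank drops. -/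
lemma corank_lt_of_leading {M : Matrix (Fin (m + 1)) (Fin (m + 1)) F} (hM : M.IsSymm)
    {v : Fin m → F} (hv : (leading M).mulVec v = 0)
    (hx : ∑ i : Fin m, M i.castSucc (Fin.last m) * v i ≠ 0) :
    corank M < corank (leading M) := by
  have hsymm : (leading M).transpose = leading M := by
    ext i j; exact hM.apply _ _
  have hdot : ∀ u : Fin m → F, v ⬝ᵥ (leading M).mulVec u = 0 := fun u => by
    rw [Matrix.dotProduct_mulVec, ← Matrix.mulVec_transpose, hsymm, hv, zero_dotProduct]
  have hlast : ∀ u : Fin (m + 1) → F, M.mulVec u = 0 → u (Fin.last m) = 0 := fun u hu => by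
    have h1 : v ⬝ᵥ (fun i : Fin m => M.mulVec u i.castSucc) = 0 := by
      rw [hu]; exact dotProduct_zero v
    have h2 : v ⬝ᵥ (fun i : Fin m => M.mulVec u i.castSucc) =
        v ⬝ᵥ (leading M).mulVec (fun j => u j.castSucc) +
          (∑ i : Fin m, M i.castSucc (Fin.last m) * v i) * u (Fin.last m) := by
      simp only [mulVec_castSucc, dotProduct, mul_add, sum_add_distrib, sum_mul]
      congr 1
      exact sum_congr rfl fun i _ => by ring
    rw [h1, hdot, zero_add] at h2
    exact (mul_eq_zero.1 h2.symm).resolve_left hx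
  let f : LinearMap.ker M.mulVecLin →ₗ[F] (Fin m → F) :=
    (LinearMap.funLeft F F Fin.castSucc).domRestrict _
  have hf : Injective f := by
    rw [← LinearMap.ker_eq_bot, LinearMap.ker_eq_bot']
    rintro ⟨u, hu⟩ hu0
    refine Subtype.ext (funext fun i => ?_)
    exact Fin.lastCases (hlast u hu) (fun j => congrFun hu0 j) i
  rw [corank, ← LinearMap.finrank_range_of_inj hf]
  refine Submodule.finrank_lt_finrank_of_lt (lt_of_le_of_ne ?_ ?_)
  · rintro _ ⟨⟨u, hu⟩, rfl⟩
    have hu : M.mulVec u = 0 := hu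
    refine LinearMap.mem_ker.2 (funext fun i => ?_)
    have := mulVec_castSucc M u i
    rw [hlast u hu, mul_zero, add_zero, hu] at this
    exact this.symm
  · intro h
    obtain ⟨⟨u, hu⟩, huv⟩ : v ∈ LinearMap.range f := h ▸ hv
    have hu : M.mulVec u = 0 := hu
    have h1 := mulVec_last M u
    rw [hu, hlast u hu, mul_zero, add_zero] at h1
    refine hx (Eq.trans (sum_congr rfl fun i _ => ?_) h1.symm)
    rw [← huv, hM.apply]
    rfl

/-- A sequence that drops whenever it is positive, and is at most one after a zero, is at most one
from index `2a - 1` on if it is at most `a` at index `a`. -/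
lemma le_one_of_drop {c : ℕ → ℕ} {a n : ℕ} (h0 : c a ≤ a)
    (hdrop : ∀ m, a ≤ m → m < n → 0 < c m → c (m + 1) < c m)
    (hone : ∀ m, a ≤ m → m < n → c m = 0 → c (m + 1) ≤ 1) {m : ℕ} (ham : a ≤ m) (hmn : m ≤ n) :
    c m ≤ max 1 (2 * a - m) := by
  induction m, ham using Nat.le_induction with
  | base => exact le_max_of_le_right (by omega)
  | succ m hm ih =>
    have ih := ih (by omega)
    rcases Nat.eq_zero_or_pos (c m) with h | h
    · exact le_max_of_le_left (hone m hm (by omega) h)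
    · have := hdrop m hm (by omega) h
      omega

end Corank

section RandomCorank

variable {p : ℕ} [Fact p.Prime]

lemma signMat_isSymm {R : Type*} [Ring R] {V : Type*} (σ : Sym2 V → Bool) :
    (signMat R σ).IsSymm := by
  ext i j
  simp [signMat, Sym2.eq_swap]

/-- The off-diagonal entries of the last column, as unordered pairs. -/
def lastCol (m : ℕ) (i : Fin m) : Sym2 (Fin (m + 1)) := s(i.castSucc, Fin.last m)

lemma lastCol_injective (m : ℕ) : Injective (lastCol m) := by
  intro i j h
  rcases Sym2.eq_iff.1 h with ⟨h1, -⟩ | ⟨h1, -⟩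
  · exact Fin.castSucc_injective m h1
  · exact absurd h1 (Fin.castSucc_lt_last i).ne

lemma leading_extend_lastCol {R : Type*} [Field R] {m : ℕ} (τ : Sym2 (Fin (m + 1)) → Bool)
    (x : Fin m → Bool) :
    leading (signMat R (extend (lastCol m) x τ)) = signMat R (τ ∘ Sym2.map Fin.castSucc) := by
  ext i j
  simp only [leading, Matrix.submatrix_apply, signMat, Matrix.of_apply, comp_apply, Sym2.map_mk]
  rw [extend_apply']
  rintro ⟨a, ha⟩
  rcases Sym2.eq_iff.1 ha with ⟨-, h⟩ | ⟨-, h⟩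
  · exact (Fin.castSucc_lt_last j).ne h.symm
  · exact (Fin.castSucc_lt_last i).ne h.symm

lemma signMat_extend_lastCol {R : Type*} [Field R] {m : ℕ} (τ : Sym2 (Fin (m + 1)) → Bool)
    (x : Fin m → Bool) (i : Fin m) :
    signMat R (extend (lastCol m) x τ) i.castSucc (Fin.last m) = sgn R (x i) := by
  simp only [signMat, Matrix.of_apply]
  rw [show s(i.castSucc, Fin.last m) = lastCol m i from rfl, (lastCol_injective m).extend_apply]

lemma signMat_extend_lastCol_last {R : Type*} [Field R] {m : ℕ} (τ : Sym2 (Fin (m + 1)) → Bool)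
    (x : Fin m → Bool) :
    signMat R (extend (lastCol m) x τ) (Fin.last m) (Fin.last m) =
      sgn R (τ s(Fin.last m, Fin.last m)) := by
  simp only [signMat, Matrix.of_apply]
  rw [extend_apply']
  rintro ⟨a, ha⟩
  rcases Sym2.eq_iff.1 ha with ⟨h, -⟩ | ⟨h, -⟩ <;> exact (Fin.castSucc_lt_last a).ne h

/-- The probability that the corank of a singular matrix does not drop when a row and a column are
added. -/
lemma pr_corank_le_leading (hp2 : p ≠ 2) {k m : ℕ} (hk : 0 < k) (hpk : p ≤ 2 ^ k)
    (hmk : m ≤ 2 ^ k) (hkm : 2 ^ 22 * k ^ 3 ≤ m) :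
    pr (fun τ : Sym2 (Fin (m + 1)) → Bool => 0 < corank (leading (signMat (ZMod p) τ)) ∧
      corank (leading (signMat (ZMod p) τ)) ≤ corank (signMat (ZMod p) τ)) ≤
      (1 / 2) ^ k + 5 / p := by
  have hinj : Injective (Sym2.map (Fin.castSucc : Fin m → Fin (m + 1))) :=
    Sym2.map.injective (Fin.castSucc_injective m)
  have hq := pr_exists_structured_le (V := Fin m) hp2 hk hpk (by simpa using hmk)
    (by simpa using hkm) 0 (J := ∅) (by simp)
  rw [compl_empty, ← pr_comp hinj] at hq
  refine (pr_le_add_of_extend (lastCol_injective m) (by positivity) fun τ hτ => ?_).trans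
    (add_le_add_left hq _)
  simp only [leading_extend_lastCol]
  by_cases hpos : 0 < corank (signMat (ZMod p) (τ ∘ Sym2.map Fin.castSucc))
  swap
  · simp only [hpos, false_and, pr_false]; positivity
  obtain ⟨v, hv0, hv⟩ := corank_pos_iff.1 hpos
  have hb : charBound v univ ≤ 5 / p := by
    by_contra hb
    exact hτ ⟨v, hv0, hv, not_le.1 hb⟩
  refine le_trans (pr_mono fun x hx => ?_) ((pr_sgn_sum_eq_le v 0).trans hb)
  by_contra hne
  refine absurd hx.2 (not_le.2 ?_)
  have := corank_lt_of_leading (M := signMat (ZMod p) (extend (lastCol m) x τ))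
    (signMat_isSymm _) (v := v) (by rw [leading_extend_lastCol, hv])
    (by simpa only [signMat_extend_lastCol] using hne)
  rwa [leading_extend_lastCol] at this

/-- Reduction to corank one: if `M` is singular, then either the corank fails to drop somewhere
in the second half of the growth process, or `M` has a nonsingular leading submatrix. -/
lemma pr_corank_pos_le (hp2 : p ≠ 2) {k n : ℕ} (hk : 0 < k) (hpk : p ≤ 2 ^ k)
    (hnk : n ≤ 2 ^ k) (hkn : 2 ^ 22 * k ^ 3 ≤ n / 2) :
    pr (fun σ : Sym2 (Fin (n + 1)) → Bool => 0 < corank (signMat (ZMod p) σ)) ≤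
      (n + 1) * ((1 / 2) ^ k + 5 / p) +
      pr (fun σ : Sym2 (Fin (n + 1)) → Bool => corank (leading (signMat (ZMod p) σ)) = 0 ∧
        0 < corank (signMat (ZMod p) σ)) := by
  -- The leading submatrix of size `m`; its value for `m > n + 1` is irrelevant.
  set red : ∀ m, (Sym2 (Fin (n + 1)) → Bool) → Sym2 (Fin m) → Bool := fun m σ =>
    σ ∘ Sym2.map (fun i : Fin m => Fin.ofNat (n + 1) i) with hred
  set c : (Sym2 (Fin (n + 1)) → Bool) → ℕ → ℕ := fun σ m =>
    corank (signMat (ZMod p) (red m σ)) with hc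
  have hlead : ∀ m σ, leading (signMat (ZMod p) (red (m + 1) σ)) = signMat (ZMod p) (red m σ) := by
    intro m σ; rfl
  have hn1 : ∀ σ, red (n + 1) σ = σ := fun σ => by
    have : (fun i : Fin (n + 1) => Fin.ofNat (n + 1) i) = id := by
      funext i; simp
    simp only [hred, this, Sym2.map_id, comp_id]
  have hfail : ∀ m ∈ Ico (n / 2) (n + 1),
      pr (fun σ => 0 < c σ m ∧ c σ m ≤ c σ (m + 1)) ≤ (1 / 2) ^ k + 5 / p := by
    intro m hm
    rw [mem_Ico] at hm
    have hinj : Injective (Sym2.map fun i : Fin (m + 1) => Fin.ofNat (n + 1) i) := by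
      refine Sym2.map.injective fun i j hij => Fin.ext ?_
      have := congrArg Fin.val hij
      simpa [Fin.ofNat, Nat.mod_eq_of_lt (show (i : ℕ) < n + 1 by omega),
        Nat.mod_eq_of_lt (show (j : ℕ) < n + 1 by omega)] using this
    have h := pr_corank_le_leading (p := p) hp2 (m := m) hk hpk (by omega) (by omega)
    rw [← pr_comp hinj] at h
    exact h
  have hcover : ∀ σ : Sym2 (Fin (n + 1)) → Bool, 0 < corank (signMat (ZMod p) σ) →
      (∃ m ∈ Ico (n / 2) (n + 1), 0 < c σ m ∧ c σ m ≤ c σ (m + 1)) ∨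
      (corank (leading (signMat (ZMod p) σ)) = 0 ∧ 0 < corank (signMat (ZMod p) σ)) := by
    intro σ hσ
    by_contra hcon
    rw [not_or] at hcon
    obtain ⟨h1, h2⟩ := hcon
    have hdrop : ∀ m, n / 2 ≤ m → m < n + 1 → 0 < c σ m → c σ (m + 1) < c σ m := by
      intro m h3 h4 h5
      by_contra h6
      exact h1 ⟨m, mem_Ico.2 ⟨h3, h4⟩, h5, not_lt.1 h6⟩
    have hcn := le_one_of_drop (c := c σ) (a := n / 2) (n := n + 1)
      ((corank_le_card _).trans_eq (Fintype.card_fin _)) hdrop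
      (fun m _ _ h => corank_le_one_of_leading _ (by rw [hlead]; exact h))
      (m := n) (by omega) (by omega)
    have e1 : corank (leading (signMat (ZMod p) σ)) = c σ n := by
      simp only [hc]; rw [← hlead, hn1]
    have e2 : corank (signMat (ZMod p) σ) = c σ (n + 1) := by
      simp only [hc]; rw [hn1]
    rw [e1, e2] at h2
    rw [e2] at hσ
    rcases Nat.eq_zero_or_pos (c σ n) with h | h
    · exact h2 ⟨h, hσ⟩
    · have := hdrop n (by omega) (by omega) h
      omega
  refine (pr_mono hcover).trans ((pr_or_le _ _).trans (add_le_add_left ?_ _))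
  refine (pr_exists_le _ _).trans ((sum_le_card_nsmul _ _ _ hfail).trans ?_)
  rw [nsmul_eq_mul, Nat.card_Ico]
  refine mul_le_mul_of_nonneg_right ?_ (by positivity)
  have : n + 1 - n / 2 ≤ n + 1 := by omega
  exact_mod_cast this

end RandomCorank

/-! ### Decoupling the quadratic form -/

section Decoupling

lemma pr_prod_le_of_forall_left {α β : Type*} [Fintype α] [Fintype β] {q : α × β → Prop} {c : ℝ}
    (hc : 0 ≤ c) (h : ∀ a, pr (fun b => q (a, b)) ≤ c) : pr q ≤ c := by
  rw [pr_prod]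
  rcases isEmpty_or_nonempty α with he | he
  · simpa using hc
  · exact expect_le univ_nonempty fun a _ => h a

lemma pr_prod_le_of_forall_right {α β : Type*} [Fintype α] [Fintype β] {q : α × β → Prop} {c : ℝ}
    (hc : 0 ≤ c) (h : ∀ b, pr (fun a => q (a, b)) ≤ c) : pr q ≤ c := by
  rw [← pr_equiv (Equiv.prodComm β α) q]
  exact pr_prod_le_of_forall_left hc h

variable {F : Type*} [Field F]

/-- If `M` is nonsingular but its extension by one row and column is singular, then the new
column lies on a quadric. -/
lemma dotProduct_inv_mulVec_eq {m : ℕ} {M : Matrix (Fin (m + 1)) (Fin (m + 1)) F}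
    (hM : M.IsSymm) (h0 : corank (leading M) = 0) (h1 : 0 < corank M) :
    (fun i : Fin m => M i.castSucc (Fin.last m)) ⬝ᵥ
      (leading M)⁻¹.mulVec (fun i : Fin m => M i.castSucc (Fin.last m)) =
        M (Fin.last m) (Fin.last m) := by
  obtain ⟨v, hv0, hv⟩ := corank_pos_iff.1 h1
  have hdet : IsUnit (leading M).det := by
    rw [isUnit_iff_ne_zero]
    exact fun h => (corank_pos_iff_det.2 h).ne' h0
  set x := fun i : Fin m => M i.castSucc (Fin.last m) with hx
  set u := fun i : Fin m => v i.castSucc with hu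
  set c := v (Fin.last m) with hc
  have hMu : (leading M).mulVec u = -(c • x) := by
    funext i
    have := mulVec_castSucc M v i
    rw [hv] at this
    simp only [Pi.zero_apply, Pi.neg_apply, Pi.smul_apply, smul_eq_mul] at this ⊢
    linear_combination -this
  have hu' : u = -(c • (leading M)⁻¹.mulVec x) := by
    have h := congrArg ((leading M)⁻¹.mulVec) hMu
    rw [Matrix.mulVec_mulVec, Matrix.nonsing_inv_mul _ hdet, Matrix.one_mulVec,
      Matrix.mulVec_neg, Matrix.mulVec_smul] at h
    exact h
  have hc0 : c ≠ 0 := by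
    intro hc0
    rw [hc0, zero_smul, neg_zero] at hu'
    refine hv0 (funext fun i => ?_)
    exact Fin.lastCases hc0 (fun j => congrFun hu' j) i
  have hl := mulVec_last M v
  have hxu : ∑ j : Fin m, M (Fin.last m) j.castSucc * v j.castSucc = x ⬝ᵥ u :=
    sum_congr rfl fun j _ => by rw [hM.apply]
  rw [hv, hxu, hu', dotProduct_neg, dotProduct_smul] at hl
  simp only [Pi.zero_apply, smul_eq_mul] at hl
  exact mul_left_cancel₀ hc0 (by linear_combination hl)

/-- The second difference of a quadratic form is bilinear. -/
lemma second_difference_eq {V : Type*} [Fintype V] {A : Matrix V V F} (hA : A.IsSymm)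
    (h2 : (2 : F) ≠ 0) {a a' b b' : V → F} {d : F} (h1 : (a + b) ⬝ᵥ A.mulVec (a + b) = d)
    (h3 : (a + b') ⬝ᵥ A.mulVec (a + b') = d) (h4 : (a' + b) ⬝ᵥ A.mulVec (a' + b) = d)
    (h5 : (a' + b') ⬝ᵥ A.mulVec (a' + b') = d) :
    a ⬝ᵥ A.mulVec (b - b') = a' ⬝ᵥ A.mulVec (b - b') := by
  have hs : ∀ x y : V → F, x ⬝ᵥ A.mulVec y = y ⬝ᵥ A.mulVec x := fun x y => by
    rw [Matrix.dotProduct_mulVec, ← Matrix.mulVec_transpose, hA.eq, dotProduct_comm]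
  simp only [Matrix.mulVec_add, Matrix.mulVec_sub, dotProduct_add, add_dotProduct,
    dotProduct_sub] at *
  refine mul_left_cancel₀ h2 ?_
  have e1 := hs b a'
  have e2 := hs b' a'
  have e3 := hs b a
  have e4 := hs b' a
  linear_combination h1 - h3 - h4 + h5 + (- e3 + e4 + e1 - e2)

variable {p : ℕ} [Fact p.Prime]

lemma pr_eqOn_le {V : Type*} [Fintype V] [DecidableEq V] (J : Finset V) :
    pr (fun z : (V → Bool) × (V → Bool) => ∀ i ∈ J, z.1 i = z.2 i) ≤ (1 / 2) ^ #J := by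
  classical
  refine pr_prod_le_of_forall_left (by positivity) fun z => ?_
  rw [pr_forall (fun i b => i ∈ J → z i = b), ← prod_subset (subset_univ J) fun i _ hi => by
    simp [hi, pr]]
  refine (prod_le_prod (fun i _ => pr_nonneg _) (g := fun _ => 1 / 2) fun i hi => ?_).trans_eq
    (by rw [prod_const])
  simp only [hi, forall_const]
  rw [pr_eq_card, filter_eq univ (z i)]
  simp

lemma pr_sgn_sum_collision_le {V : Type*} [Fintype V] [DecidableEq V] (u : V → ZMod p)
    (I : Finset V) {c : ℝ} (hc : 0 ≤ c) :
    pr (fun y : (V → Bool) × (V → Bool) => charBound u I ≤ c ∧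
      ∑ i ∈ I, sgn (ZMod p) (y.1 i) * u i = ∑ i ∈ I, sgn (ZMod p) (y.2 i) * u i) ≤ c := by
  by_cases h : charBound u I ≤ c
  · simp only [h, true_and]
    refine pr_prod_le_of_forall_right hc fun y' => ?_
    exact (pr_sgn_sum_mem_eq_le u I (∑ i ∈ I, sgn (ZMod p) (y' i) * u i)).trans h
  · simpa only [h, false_and, pr_false] using hc

/-- The sign vector of `x`. -/
def sgnVec (F : Type*) [Ring F] {V : Type*} (x : V → Bool) (i : V) : F := sgn F (x i)

/-- The sign vector of `x` restricted to the coordinates in `I`. -/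
def sgnVecOn (F : Type*) [Ring F] {V : Type*} [DecidableEq V] (I : Finset V) (x : V → Bool)
    (i : V) : F :=
  if i ∈ I then sgn F (x i) else 0

lemma sgnVec_piecewise {V : Type*} [Fintype V] [DecidableEq V] (J : Finset V) (y z : V → Bool) :
    sgnVec F (J.piecewise z y) = sgnVecOn F Jᶜ y + sgnVecOn F J z := by
  funext i
  by_cases hi : i ∈ J <;> simp [sgnVec, sgnVecOn, hi]

/-- Decoupling: a nonsingular random symmetric sign matrix is unlikely to become singular when a
random row and column are added. Two applications of Cauchy–Schwarz to the split of the new column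
into its coordinates inside and outside `J` replace the quadratic form by a bilinear one, which is
then a random signed sum of entries of a solution `u` of `M u = w` with fixed `w`. -/
theorem pr_corank_leading_eq_zero_pow_le (hp2 : p ≠ 2) {k m : ℕ} (hk : 0 < k) (hpk : p ≤ 2 ^ k)
    (hmk : m ≤ 2 ^ k) (hkm : 2 ^ 22 * k ^ 3 ≤ m) :
    pr (fun τ : Sym2 (Fin (m + 1)) → Bool => corank (leading (signMat (ZMod p) τ)) = 0 ∧
      0 < corank (signMat (ZMod p) τ)) ^ 4 ≤ 2 * (1 / 2) ^ k + 5 / p := by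
  classical
  have hkm' : k ≤ #(univ : Finset (Fin m)) := by
    have : k ≤ k ^ 3 := Nat.le_self_pow (by norm_num) k
    rw [card_univ, Fintype.card_fin]; omega
  obtain ⟨J, -, hJ⟩ := exists_subset_card_eq hkm'
  set N : (Sym2 (Fin (m + 1)) → Bool) → Matrix (Fin m) (Fin m) (ZMod p) := fun τ =>
    signMat (ZMod p) (τ ∘ Sym2.map Fin.castSucc) with hN
  set d : (Sym2 (Fin (m + 1)) → Bool) → ZMod p := fun τ =>
    sgn (ZMod p) (τ s(Fin.last m, Fin.last m)) with hd
  set G : (Sym2 (Fin (m + 1)) → Bool) → (Fin m → Bool) → Prop := fun τ x =>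
    corank (N τ) = 0 ∧ sgnVec (ZMod p) x ⬝ᵥ (N τ)⁻¹.mulVec (sgnVec (ZMod p) x) = d τ with hG
  -- Separate the last column from the rest of the matrix, then split it along `J`.
  have h1 : pr (fun τ : Sym2 (Fin (m + 1)) → Bool => corank (leading (signMat (ZMod p) τ)) = 0 ∧
      0 < corank (signMat (ZMod p) τ)) ≤
      pr fun t : ((Sym2 (Fin (m + 1)) → Bool) × (Fin m → Bool)) × (Fin m → Bool) =>
        G t.1.1 (J.piecewise t.2 t.1.2) := by
    rw [pr_extend (lastCol_injective m), pr_prod, ← univ_product_univ, expect_product]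
    refine expect_le_expect fun τ _ => ?_
    simp only
    rw [← pr_piecewise J (G τ)]
    refine pr_mono fun x hx => ?_
    have h4 := dotProduct_inv_mulVec_eq (signMat_isSymm _) hx.1 hx.2
    simp only [leading_extend_lastCol, signMat_extend_lastCol, signMat_extend_lastCol_last] at h4
    refine ⟨?_, h4⟩
    have h5 := hx.1
    rwa [leading_extend_lastCol] at h5
  have h2 := sq_pr_le_pr_dup fun (t : (Sym2 (Fin (m + 1)) → Bool) × (Fin m → Bool))
    (z : Fin m → Bool) => G t.1 (J.piecewise z t.2)
  -- Regroup the variables so that the coordinates outside `J` come last.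
  let e : ((Sym2 (Fin (m + 1)) → Bool) × ((Fin m → Bool) × (Fin m → Bool))) × (Fin m → Bool) ≃
      ((Sym2 (Fin (m + 1)) → Bool) × (Fin m → Bool)) × ((Fin m → Bool) × (Fin m → Bool)) :=
    { toFun := fun t => ((t.1.1, t.2), t.1.2)
      invFun := fun t => ((t.1.1, t.2), t.1.2)
      left_inv := fun _ => rfl
      right_inv := fun _ => rfl }
  rw [← pr_equiv e] at h2
  have h3 := sq_pr_le_pr_dup
    fun (t : (Sym2 (Fin (m + 1)) → Bool) × ((Fin m → Bool) × (Fin m → Bool)))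
      (y : Fin m → Bool) => G t.1 (J.piecewise t.2.1 y) ∧ G t.1 (J.piecewise t.2.2 y)
  set w : (Fin m → Bool) × (Fin m → Bool) → Fin m → ZMod p := fun z =>
    sgnVecOn (ZMod p) J z.1 - sgnVecOn (ZMod p) J z.2 with hw
  have hcover : ∀ t : ((Sym2 (Fin (m + 1)) → Bool) × ((Fin m → Bool) × (Fin m → Bool))) ×
      ((Fin m → Bool) × (Fin m → Bool)),
      ((G t.1.1 (J.piecewise t.1.2.1 t.2.1) ∧ G t.1.1 (J.piecewise t.1.2.2 t.2.1)) ∧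
        (G t.1.1 (J.piecewise t.1.2.1 t.2.2) ∧ G t.1.1 (J.piecewise t.1.2.2 t.2.2))) →
      ((∀ i ∈ J, t.1.2.1 i = t.1.2.2 i) ∨
        (∃ v, v ≠ 0 ∧ (N t.1.1).mulVec v = w t.1.2 ∧ 5 / p < charBound v Jᶜ)) ∨
      (charBound ((N t.1.1)⁻¹.mulVec (w t.1.2)) Jᶜ ≤ 5 / p ∧
        ∑ i ∈ Jᶜ, sgn (ZMod p) (t.2.1 i) * (N t.1.1)⁻¹.mulVec (w t.1.2) i =
          ∑ i ∈ Jᶜ, sgn (ZMod p) (t.2.2 i) * (N t.1.1)⁻¹.mulVec (w t.1.2) i) := by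
    rintro ⟨⟨τ, z, z'⟩, y, y'⟩ ⟨⟨⟨hcor, g1⟩, -, g2⟩, ⟨-, g3⟩, -, g4⟩
    simp only [sgnVec_piecewise] at g1 g2 g3 g4
    have hdet : IsUnit (N τ).det := by
      rw [isUnit_iff_ne_zero]
      exact fun h => (corank_pos_iff_det.2 h).ne' hcor
    have hsymm : ((N τ)⁻¹).IsSymm := (signMat_isSymm _).inv
    have hdiff := second_difference_eq hsymm (two_ne_zero_zmod hp2) g1 g2 g3 g4
    have hdot : ∀ y : Fin m → Bool, ∀ u : Fin m → ZMod p,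
        sgnVecOn (ZMod p) Jᶜ y ⬝ᵥ u = ∑ i ∈ Jᶜ, sgn (ZMod p) (y i) * u i := fun y u => by
      simp only [dotProduct, sgnVecOn, ite_mul, zero_mul]
      rw [sum_ite_mem, univ_inter]
    rw [hdot, hdot] at hdiff
    have hsol : (N τ).mulVec ((N τ)⁻¹.mulVec (w (z, z'))) = w (z, z') := by
      rw [Matrix.mulVec_mulVec, Matrix.mul_nonsing_inv _ hdet, Matrix.one_mulVec]
    by_cases hz : ∀ i ∈ J, z i = z' i
    · exact Or.inl (Or.inl hz)
    rcases lt_or_ge (5 / p : ℝ) (charBound ((N τ)⁻¹.mulVec (w (z, z'))) Jᶜ) with hb | hb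
    · refine Or.inl (Or.inr ⟨_, fun h0 => hz fun i hi => ?_, hsol, hb⟩)
      rw [h0, Matrix.mulVec_zero] at hsol
      have hi' := congrFun hsol i
      have h4 : (1 : ZMod p) ≠ -1 := fun h => two_ne_zero_zmod hp2 (by linear_combination h)
      simp only [hw, Pi.zero_apply, Pi.sub_apply, sgnVecOn, hi, if_true] at hi'
      have hi'' := sub_eq_zero.1 hi'.symm
      revert hi''
      cases z i <;> cases z' i <;> simp [sgn, h4, h4.symm]
    · exact Or.inr ⟨hb, hdiff⟩
  have hinj : Injective (Sym2.map (Fin.castSucc : Fin m → Fin (m + 1))) :=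
    Sym2.map.injective (Fin.castSucc_injective m)
  have hA : pr (fun t : ((Sym2 (Fin (m + 1)) → Bool) × ((Fin m → Bool) × (Fin m → Bool))) ×
      ((Fin m → Bool) × (Fin m → Bool)) => ∀ i ∈ J, t.1.2.1 i = t.1.2.2 i) ≤ (1 / 2) ^ k := by
    refine pr_prod_le_of_forall_right (by positivity) fun _ => ?_
    refine pr_prod_le_of_forall_left (by positivity) fun _ => ?_
    exact (pr_eqOn_le J).trans_eq (by rw [hJ])
  have hB : pr (fun t : ((Sym2 (Fin (m + 1)) → Bool) × ((Fin m → Bool) × (Fin m → Bool))) ×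
      ((Fin m → Bool) × (Fin m → Bool)) =>
      ∃ v, v ≠ 0 ∧ (N t.1.1).mulVec v = w t.1.2 ∧ 5 / p < charBound v Jᶜ) ≤ (1 / 2) ^ k := by
    refine pr_prod_le_of_forall_right (by positivity) fun _ => ?_
    refine pr_prod_le_of_forall_right (by positivity) fun z => ?_
    have hq := pr_exists_structured_le (V := Fin m) hp2 hk hpk (by simpa using hmk)
      (by simpa using hkm) (w z) hJ.le
    rwa [← pr_comp hinj] at hq
  have hC : pr (fun t : ((Sym2 (Fin (m + 1)) → Bool) × ((Fin m → Bool) × (Fin m → Bool))) ×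
      ((Fin m → Bool) × (Fin m → Bool)) =>
      charBound ((N t.1.1)⁻¹.mulVec (w t.1.2)) Jᶜ ≤ 5 / p ∧
        ∑ i ∈ Jᶜ, sgn (ZMod p) (t.2.1 i) * (N t.1.1)⁻¹.mulVec (w t.1.2) i =
          ∑ i ∈ Jᶜ, sgn (ZMod p) (t.2.2 i) * (N t.1.1)⁻¹.mulVec (w t.1.2) i) ≤ 5 / p := by
    refine pr_prod_le_of_forall_left (by positivity) fun t => ?_
    exact pr_sgn_sum_collision_le ((N t.1)⁻¹.mulVec (w t.2)) Jᶜ (by positivity)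
  have h4 := (pr_mono hcover).trans ((pr_or_le _ _).trans
    (add_le_add ((pr_or_le _ _).trans (add_le_add hA hB)) hC))
  calc pr (fun τ : Sym2 (Fin (m + 1)) → Bool => corank (leading (signMat (ZMod p) τ)) = 0 ∧
        0 < corank (signMat (ZMod p) τ)) ^ 4
      ≤ (pr fun t : ((Sym2 (Fin (m + 1)) → Bool) × (Fin m → Bool)) × (Fin m → Bool) =>
        G t.1.1 (J.piecewise t.2 t.1.2)) ^ 4 := pow_le_pow_left₀ (pr_nonneg _) h1 4
    _ = ((pr fun t : ((Sym2 (Fin (m + 1)) → Bool) × (Fin m → Bool)) × (Fin m → Bool) =>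
        G t.1.1 (J.piecewise t.2 t.1.2)) ^ 2) ^ 2 := by ring
    _ ≤ _ := pow_le_pow_left₀ (sq_nonneg _) h2 2
    _ ≤ _ := h3
    _ ≤ (1 / 2) ^ k + (1 / 2) ^ k + 5 / p := h4
    _ = _ := by ring

/-- The resulting bound for the singularity probability over `ℤ/pℤ`. -/
theorem pr_det_eq_zero_le (hp2 : p ≠ 2) {k n : ℕ} (hk : 0 < k) (hpk : p ≤ 2 ^ k)
    (hnk : n ≤ 2 ^ k) (hkn : 2 ^ 22 * k ^ 3 ≤ n / 2) :
    pr (fun σ : Sym2 (Fin (n + 1)) → Bool => (signMat (ZMod p) σ).det = 0) ≤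
      (n + 1) * ((1 / 2) ^ k + 5 / p) + (2 * (1 / 2) ^ k + 5 / p) ^ (1 / 4 : ℝ) := by
  simp only [← corank_pos_iff_det]
  refine (pr_corank_pos_le hp2 hk hpk hnk hkn).trans ?_
  gcongr
  have h := pr_corank_leading_eq_zero_pow_le hp2 (m := n) hk hpk hnk (by omega)
  rw [← Real.rpow_le_rpow_iff (z := 1 / 4) (pow_nonneg (pr_nonneg _) _) (by positivity)
    (by norm_num), ← Real.rpow_natCast, ← Real.rpow_mul (pr_nonneg _)] at h
  norm_num at h ⊢
  exact h

end Decoupling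

/-! ### From the probability space to counting sign patterns -/

section Transfer

lemma signLaw_singleton_sgn (b : Bool) : signLaw {sgn ℝ b} = 1 / 2 := by
  cases b <;> simp [signLaw, sgn] <;> norm_num

lemma signLaw_compl : signLaw {(1 : ℝ), -1}ᶜ = 0 := by
  simp [signLaw]

lemma map_signMat {R : Type*} [CommRing R] {V : Type*} [Fintype V] [DecidableEq V]
    (σ : Sym2 V → Bool) : (signMat ℤ σ).map (Int.castRingHom R) = signMat R σ := by
  ext i j
  cases h : σ s(i, j) <;> simp [signMat, sgn, h]

lemma det_signMat_zmod_eq_zero {p : ℕ} {V : Type*} [Fintype V] [DecidableEq V]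
    {σ : Sym2 V → Bool} (h : (signMat ℝ σ).det = 0) : (signMat (ZMod p) σ).det = 0 := by
  have hdet : ∀ (R : Type) [CommRing R], (signMat R σ).det = Int.castRingHom R (signMat ℤ σ).det :=
    fun R _ => by rw [RingHom.map_det, RingHom.mapMatrix_apply, map_signMat]
  rw [hdet ℝ] at h
  rw [hdet (ZMod p), (Int.castRingHom ℝ).injective_int (h.trans (map_zero _).symm), map_zero]

/-- The law of a random symmetric sign matrix is uniform on the sign patterns. -/
lemma measureReal_det_eq_zero_le {Ω : Type*} [MeasurableSpace Ω] {P : Measure Ω}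
    {n : ℕ} {M : Ω → Matrix (Fin n) (Fin n) ℝ}
    (hM : IsRandomSymmetricSignMatrix P n M) :
    P.real {ω | (M ω).det = 0} ≤
      pr fun σ : Sym2 (Fin n) → Bool => (signMat ℝ σ).det = 0 := by
  classical
  set T := {q : Fin n × Fin n // q.1 ≤ q.2} with hT
  have hlaw : ∀ (q : T) {s : Set ℝ}, MeasurableSet s →
      P ((fun ω => M ω q.1.1 q.1.2) ⁻¹' s) = signLaw s := fun q s hs => by
    have h := hM.hasLaw q.1.1 q.1.2 q.2
    rw [← h.map_eq, Measure.map_apply_of_aemeasurable h.aemeasurable hs]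
  set A : (Sym2 (Fin n) → Bool) → Set Ω := fun σ =>
    ⋂ q : T, (fun ω => M ω q.1.1 q.1.2) ⁻¹' {sgn ℝ (σ s(q.1.1, q.1.2))} with hA
  have hPA : ∀ σ, P (A σ) = (1 / 2) ^ Fintype.card (Sym2 (Fin n)) := fun σ => by
    have h := hM.indep.meas_iInter
      (s := fun q : T => (fun ω => M ω q.1.1 q.1.2) ⁻¹' {sgn ℝ (σ s(q.1.1, q.1.2))})
      fun q => ⟨_, measurableSet_singleton _, rfl⟩
    rw [hA, h, prod_congr rfl fun q _ => (hlaw q (measurableSet_singleton _)).trans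
      (signLaw_singleton_sgn _), prod_const, card_univ,
      Fintype.card_congr (Sym2.sortEquiv (α := Fin n))]
  have hcover : {ω | (M ω).det = 0} ⊆
      (⋃ σ ∈ (univ : Finset (Sym2 (Fin n) → Bool)).filter (fun σ => (signMat ℝ σ).det = 0), A σ) ∪
        ⋃ q : T, (fun ω => M ω q.1.1 q.1.2) ⁻¹' {(1 : ℝ), -1}ᶜ := by
    intro ω hω
    by_contra hcon
    rw [Set.mem_union, not_or] at hcon
    obtain ⟨h1, h2⟩ := hcon
    have hval : ∀ q : T, M ω q.1.1 q.1.2 = sgn ℝ (decide (M ω q.1.1 q.1.2 = 1)) := fun q => by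
      have h3 := not_not.1 fun hq => h2 (Set.mem_iUnion.2 ⟨q, hq⟩)
      rcases h3 with h3 | h3
      · simp [h3, sgn]
      · have h3 : M ω q.1.1 q.1.2 = -1 := h3
        rw [h3]; norm_num [sgn]
    set σ : Sym2 (Fin n) → Bool := fun z =>
      decide (M ω (Sym2.sortEquiv z).1.1 (Sym2.sortEquiv z).1.2 = 1) with hσ
    have hσq : ∀ q : T, M ω q.1.1 q.1.2 = sgn ℝ (σ s(q.1.1, q.1.2)) := fun q => by
      have h4 : Sym2.sortEquiv s(q.1.1, q.1.2) = q := Sym2.sortEquiv.apply_symm_apply q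
      simp only [hσ, h4]
      exact hval q
    have hMσ : M ω = signMat ℝ σ := by
      ext i j
      rcases le_total i j with h | h
      · exact hσq ⟨(i, j), h⟩
      · exact ((hM.isSymm ω).apply i j).symm.trans
          ((hσq ⟨(j, i), h⟩).trans ((signMat_isSymm σ).apply i j))
    refine h1 (Set.mem_iUnion₂.2 ⟨σ, mem_filter.2 ⟨mem_univ _, ?_⟩, Set.mem_iInter.2 hσq⟩)
    rw [← hMσ]; exact hω
  have hnull : P (⋃ q : T, (fun ω => M ω q.1.1 q.1.2) ⁻¹' {(1 : ℝ), -1}ᶜ) = 0 :=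
    measure_iUnion_null fun q => (hlaw q (by measurability)).trans signLaw_compl
  have hle : P {ω | (M ω).det = 0} ≤
      #((univ : Finset (Sym2 (Fin n) → Bool)).filter fun σ => (signMat ℝ σ).det = 0) *
        (1 / 2) ^ Fintype.card (Sym2 (Fin n)) := by
    refine (measure_mono hcover).trans ((measure_union_le _ _).trans ?_)
    rw [hnull, add_zero]
    refine (measure_biUnion_finset_le _ _).trans ?_
    rw [sum_congr rfl fun σ _ => hPA σ, sum_const, nsmul_eq_mul]
  rw [pr_eq_card, Measure.real]
  refine (ENNReal.toReal_mono (ENNReal.mul_ne_top (ENNReal.natCast_ne_top _)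
    (ENNReal.pow_ne_top (by simp))) hle).trans_eq ?_
  rw [ENNReal.toReal_mul, ENNReal.toReal_pow]
  simp [div_eq_mul_inv]

end Transfer

/-! ### Choice of parameters -/

section Asymptotics

open Filter

/-- The bound for a fixed scale `k`, with a prime `p` between `2 ^ (k - 1)` and `2 ^ k`. -/
lemma measureReal_det_eq_zero_le_of_scale {Ω : Type*} [MeasurableSpace Ω] {P : Measure Ω}
    {n : ℕ} {M : Ω → Matrix (Fin n) (Fin n) ℝ} (hM : IsRandomSymmetricSignMatrix P n M)
    {k : ℕ} (hk : 8 ≤ k) (hnk : (n : ℝ) ≤ 2 ^ ((k : ℝ) / 4))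
    (hkn : 2 ^ 23 * k ^ 3 + 1 ≤ n) :
    P.real {ω | (M ω).det = 0} ≤ 3 * 2 ^ (-((k : ℝ) / 4)) := by
  obtain ⟨m, rfl⟩ : ∃ m, n = m + 1 := ⟨n - 1, by omega⟩
  obtain ⟨p, hp, hp1, hp2⟩ := Nat.exists_prime_lt_and_le_two_mul (2 ^ (k - 1)) (by positivity)
  have : Fact p.Prime := ⟨hp⟩
  have hkk : 2 * 2 ^ (k - 1) = 2 ^ k := by rw [← pow_succ', Nat.sub_add_cancel (by omega)]
  rw [hkk] at hp2
  have hp2' : p ≠ 2 := by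
    have : 2 ^ 1 ≤ 2 ^ (k - 1) := Nat.pow_le_pow_right (by norm_num) (by omega)
    omega
  set t : ℝ := 2 ^ (-((k : ℝ) / 4)) with ht
  have ht0 : 0 < t := by positivity
  have ht4 : t ^ 4 = (1 / 2) ^ k := by
    rw [ht, ← Real.rpow_natCast, ← Real.rpow_mul (by norm_num), one_div, inv_pow,
      ← Real.rpow_natCast, ← Real.rpow_neg (by norm_num)]
    congr 1; push_cast; ring
  have hnt : ((m + 1 : ℕ) : ℝ) * t ≤ 1 := by
    calc ((m + 1 : ℕ) : ℝ) * t ≤ 2 ^ ((k : ℝ) / 4) * t := by gcongr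
      _ = 1 := by rw [ht, ← Real.rpow_add (by norm_num), add_neg_cancel, Real.rpow_zero]
  have ht1 : t ≤ 1 / 4 := by
    calc t ≤ 2 ^ (-2 : ℝ) := by
          refine Real.rpow_le_rpow_of_exponent_le (by norm_num) ?_
          have : (8 : ℝ) ≤ k := by exact_mod_cast hk
          linarith
      _ = 1 / 4 := by rw [Real.rpow_neg (by norm_num)]; norm_num
  have hmk : m ≤ 2 ^ k := by
    have h1 : ((m + 1 : ℕ) : ℝ) ≤ 2 ^ (k : ℝ) := hnk.trans <|
      Real.rpow_le_rpow_of_exponent_le (by norm_num) (by linarith [(Nat.cast_nonneg k : (0:ℝ) ≤ k)])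
    rw [Real.rpow_natCast] at h1
    have h2 : m + 1 ≤ 2 ^ k := by exact_mod_cast h1
    omega
  have h5p : (5 : ℝ) / p ≤ 10 * t ^ 4 := by
    have h1 : (2 : ℝ) ^ k ≤ 2 * p := by exact_mod_cast (by omega : 2 ^ k ≤ 2 * p)
    have hp0 : (0 : ℝ) < p := by exact_mod_cast hp.pos
    rw [ht4, one_div_pow, mul_one_div, div_le_div_iff₀ hp0 (by positivity)]
    linarith
  have hmain := pr_det_eq_zero_le (p := p) hp2' (n := m) (by omega) hp2 hmk
    (by rw [Nat.le_div_iff_mul_le (by norm_num)]; omega)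
  calc P.real {ω | (M ω).det = 0}
      ≤ pr fun σ : Sym2 (Fin (m + 1)) → Bool => (signMat ℝ σ).det = 0 :=
        measureReal_det_eq_zero_le hM
    _ ≤ pr fun σ : Sym2 (Fin (m + 1)) → Bool => (signMat (ZMod p) σ).det = 0 :=
        pr_mono fun σ h => det_signMat_zmod_eq_zero h
    _ ≤ _ := hmain
    _ ≤ (m + 1) * (11 * t ^ 4) + (12 * t ^ 4) ^ (1 / 4 : ℝ) := by
        -- Here `5 / p` is at most `10 * t ^ 4`, and `10 + 1 = 11`, `10 + 2 = 12`.
        rw [← ht4]; gcongr <;> linarith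
    _ ≤ (m + 1) * (11 * t ^ 4) + ((2 * t) ^ 4) ^ (1 / 4 : ℝ) := by
        gcongr
        rw [mul_pow]
        have : 0 < t ^ 4 := by positivity
        linarith
    _ = (((m + 1 : ℕ) : ℝ) * t) * (11 * t ^ 3) + 2 * t := by
        rw [← Real.rpow_natCast (2 * t), ← Real.rpow_mul (by positivity)]
        push_cast
        norm_num
        ring
    _ ≤ 1 * (11 * t ^ 3) + 2 * t := by gcongr
    _ ≤ 3 * t := by nlinarith [mul_pos ht0 ht0]

/-- The scale `k = ⌈n ^ (1/4) * √(log n)⌉` meets the requirements for all large `n`; they only need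
`k` to lie between `C * log n` and `c * n ^ (1/3)`. -/
lemma eventually_scale_bounds : ∀ᶠ n : ℕ in atTop,
    8 ≤ ⌈(n : ℝ) ^ (1 / 4 : ℝ) * Real.sqrt (Real.log n)⌉₊ ∧
    16 ≤ (n : ℝ) ^ (1 / 4 : ℝ) * Real.sqrt (Real.log n) ∧
    (n : ℝ) ≤ 2 ^ ((⌈(n : ℝ) ^ (1 / 4 : ℝ) * Real.sqrt (Real.log n)⌉₊ : ℝ) / 4) ∧
    2 ^ 23 * ⌈(n : ℝ) ^ (1 / 4 : ℝ) * Real.sqrt (Real.log n)⌉₊ ^ 3 + 1 ≤ n := by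
  have hl1 := (isLittleO_log_rpow_atTop (r := 1 / 10) (by norm_num)).bound one_pos
  have hl2 := (isLittleO_log_rpow_atTop (r := 1 / 4) (by norm_num)).bound
    (show (0 : ℝ) < 1 / 8 by norm_num)
  have hb1 := (tendsto_rpow_atTop (show (0 : ℝ) < 1 / 10 by norm_num)).eventually_ge_atTop (2 ^ 27)
  have hb2 := (tendsto_rpow_atTop (show (0 : ℝ) < 1 / 4 by norm_num)).eventually_ge_atTop 16
  have hb3 := (tendsto_rpow_atTop (show (0 : ℝ) < 3 / 10 by norm_num)).eventually_ge_atTop 1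
  have hlog := Real.tendsto_log_atTop.eventually_ge_atTop 1
  have hall := (tendsto_natCast_atTop_atTop (R := ℝ)).eventually (hl1.and (hl2.and (hb1.and
    (hb2.and (hb3.and (hlog.and (eventually_ge_atTop (4 : ℝ))))))))
  filter_upwards [hall] with n h
  obtain ⟨h1, h2, h3, h4, h5, h6, h7⟩ := h
  set x : ℝ := (n : ℝ) with hx
  have hx0 : 0 < x := by linarith
  rw [Real.norm_of_nonneg (by linarith), Real.norm_of_nonneg (by positivity)] at h1 h2
  set L := x ^ (1 / 4 : ℝ) * Real.sqrt (Real.log x) with hL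
  have hsq1 : 1 ≤ Real.sqrt (Real.log x) := Real.one_le_sqrt.2 h6
  have hL1 : x ^ (1 / 4 : ℝ) ≤ L := le_mul_of_one_le_right (by positivity) hsq1
  have hLk : L ≤ ⌈L⌉₊ := Nat.le_ceil L
  have hL3 : L ≤ x ^ (3 / 10 : ℝ) := by
    have hsq : Real.sqrt (Real.log x) ≤ x ^ (1 / 20 : ℝ) := by
      rw [Real.sqrt_le_left (by positivity), ← Real.rpow_natCast, ← Real.rpow_mul hx0.le]
      norm_num at h1 ⊢
      exact h1
    calc L ≤ x ^ (1 / 4 : ℝ) * x ^ (1 / 20 : ℝ) := by rw [hL]; gcongr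
      _ = _ := by rw [← Real.rpow_add hx0]; norm_num
  have hk3 : (⌈L⌉₊ : ℝ) ≤ 2 * x ^ (3 / 10 : ℝ) := by
    have := (Nat.ceil_lt_add_one (show 0 ≤ L by positivity)).le
    linarith
  refine ⟨?_, by linarith, ?_, ?_⟩
  · have : (8 : ℝ) ≤ ⌈L⌉₊ := by linarith
    exact_mod_cast this
  · rw [← Real.log_le_log_iff hx0 (by positivity), Real.log_rpow (by norm_num)]
    have := Real.log_two_gt_d9
    have h8 : (0 : ℝ) ≤ ⌈L⌉₊ := Nat.cast_nonneg _
    nlinarith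
  · have h8 : (⌈L⌉₊ : ℝ) ^ 3 ≤ 8 * x ^ (9 / 10 : ℝ) := by
      calc (⌈L⌉₊ : ℝ) ^ 3 ≤ (2 * x ^ (3 / 10 : ℝ)) ^ 3 := by gcongr
        _ = 8 * x ^ (9 / 10 : ℝ) := by
          rw [mul_pow, ← Real.rpow_natCast (x ^ _), ← Real.rpow_mul hx0.le]; norm_num
    have h9 : x = x ^ (9 / 10 : ℝ) * x ^ (1 / 10 : ℝ) := by
      rw [← Real.rpow_add hx0]; norm_num
    have h10 : 2 ^ 27 * x ^ (9 / 10 : ℝ) ≤ x := by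
      nlinarith [Real.rpow_pos_of_pos hx0 (9 / 10)]
    have h11 : (2 : ℝ) ^ 23 * (⌈L⌉₊ : ℝ) ^ 3 + 1 ≤ n := by
      rw [← hx]; linarith
    exact_mod_cast h11

end Asymptotics

theorem theorem1p2 :
    ∃ n₀ : ℕ, ∀ n : ℕ, n₀ ≤ n →
      ∀ (Ω : Type*) [MeasurableSpace Ω] (P : Measure Ω) [IsProbabilityMeasure P]
        (M : Ω → Matrix (Fin n) (Fin n) ℝ),
        IsRandomSymmetricSignMatrix P n M →
          P.real {ω | (M ω).det = 0} ≤
            (2 : ℝ) ^ (-((n : ℝ) ^ (1 / 4 : ℝ) * Real.sqrt (Real.log n) / 1000)) := by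
  obtain ⟨n₀, h₀⟩ := Filter.eventually_atTop.1 eventually_scale_bounds
  refine ⟨n₀, fun n hn Ω _ P _ M hM => ?_⟩
  obtain ⟨h1, h2, h3, h4⟩ := h₀ n hn
  refine (measureReal_det_eq_zero_le_of_scale hM h1 h3 h4).trans ?_
  set L := (n : ℝ) ^ (1 / 4 : ℝ) * Real.sqrt (Real.log n) with hL
  have hk : L ≤ ⌈L⌉₊ := Nat.le_ceil L
  calc (3 : ℝ) * 2 ^ (-((⌈L⌉₊ : ℝ) / 4)) ≤ 2 ^ (2 : ℝ) * 2 ^ (-((⌈L⌉₊ : ℝ) / 4)) := by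
        gcongr; norm_num
    _ = 2 ^ (2 - (⌈L⌉₊ : ℝ) / 4) := by rw [← Real.rpow_add (by norm_num), sub_eq_add_neg]
    _ ≤ 2 ^ (-(L / 1000)) := Real.rpow_le_rpow_of_exponent_le (by norm_num) (by linarith)
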